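/- Let $G$ be a directed multigraph with finite vertex set $V$ and finite edge set $E$, in which every edge $e$ has a weight $W(e)>0$. A path is a non-empty list of edges, each of which starts where the preceding one ends (vertices and edges may be repeated); its weight is the sum of the weights of its edges. Write $u\leftrightarrow v$ if there is a path from $u$ to $v$ and a path from $v$ to $u$, and $[u]=\{v: u\leftrightarrow v\}$. The non-empty classes $[u]$ are the strongly connected components (so a vertex on no closed path belongs to none of them). A component is a cycle if, in the graph that it induces, every vertex has in-degree and out-degree $1$; its cycle weight is then the weight of one turn around it. Let $v_1,v_2\in V$, let $X$ be the set of paths from $v_1$ to $v_2$, suppose that $X\ne\emptyset$, and let $\mathcal V(X)$ be the set of vertices met by the paths in $X$. If $X$ is infinite, let $p_1\le p_2\le\cdots$ be the list of the weights of the paths in $X$ in non-decreasing order, with one entry for each path. 1. If no strongly connected component lies on $\mathcal V(X)$, then $X$ is finite. 2. Suppose that at least one strongly connected component lies on $\mathcal V(X)$ and that every such component is a cycle. Then $X$ is infinite, its weights can be so listed, and $$\lim_{r\to\infty}\frac{p_r^{\,c}}{r}=s,$$ where $c\ge 1$ is the greatest number of components met by one path in $X$, and $s>0$ is given as follows. The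 itinerary of a path is obtained from the list of the vertices along it by replacing $a\,b\,c$ by $a\,c$ wherever $a\leftrightarrow b\leftrightarrow c$ until no such triple is left. Let $S$ be the set of those itineraries $\sigma=\sigma_1\dots\sigma_m$ of paths in $X$ for which exactly $c$ indices $i<m$ satisfy $\sigma_i\leftrightarrow\sigma_{i+1}$. For $\sigma\in S$ let $w_1(\sigma),\dots,w_c(\sigma)$ be the cycle weights of the components $[\sigma_i]$ for these indices, and let $N(\sigma)$ be the product, over the other indices $i<m$, of the number of edges from $\sigma_i$ to $\sigma_{i+1}$. Then $$\frac1s=\sum_{\sigma\in S}\frac{N(\sigma)}{c!\,w_1(\sigma)\cdots w_c(\sigma)} .$$ 3. Suppose that at least one strongly connected component on $\mathcal V(X)$ is not a cycle. Then $X$ is infinite and its weights can be so listed. For each such component $C$ there is exactly one number $s_C>0$ for which the matrix indexed by $C$ with entries $$b_{ij}=\sum_{e\text{ from }j\text{ to }i}e^{-W(e)/s_C}$$ has spectral radius $1$, and $$\lim_{r\to\infty}\frac{p_r}{\log r}=s,$$ where $s$ is the smallest of the numbers $s_C$ over the components $C$ on $\mathcal V(X)$ that are not cycles. -/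

import Mathlib

open Filter Topology

noncomputable section

/-- An edge-weighted directed multigraph with vertex type `V` and edge type `E`: the edge `e` goes
from `I e` to `O e` and has weight `W e > 0`. -/
structure WeightedDigraph (V E : Type*) where
  I : E → V
  O : E → V
  W : E → ℝ
  W_pos : ∀ e, 0 < W e

namespace WeightedDigraph

variable {V E : Type*} (G : WeightedDigraph V E)

/-- The set `X(u, v)` of paths from `u` to `v`: non-empty lists of edges, each edge starting where
the preceding one ends, the first one starting at `u` and the last one ending at `v`. -/
def paths (u v : V) : Set (List E) :=
  {x | x.IsChain (fun e f => G.I f = G.O e) ∧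
    ∃ h : x ≠ [], G.I (x.head h) = u ∧ G.O (x.getLast h) = v}

/-- The weight of a path, the sum of the weights of its edges. -/
def weight (x : List E) : ℝ := (x.map G.W).sum

/-- The set of vertices met by a path. -/
def verts (x : List E) : Set V := {v | ∃ e ∈ x, v = G.I e ∨ v = G.O e}

/-- The set of vertices met by the paths of a set of paths. -/
def vertsOf (X : Set (List E)) : Set V := {v | ∃ x ∈ X, v ∈ G.verts x}

/-- `u → v` and `v → u`. A vertex need not be related to itself, since paths are non-empty. -/
def Conn (u v : V) : Prop := (G.paths u v).Nonempty ∧ (G.paths v u).Nonempty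

/-- The class `[u]`. -/
def cls (u : V) : Set V := {v | G.Conn u v}

/-- The strongly connected components: the non-empty classes `[u]`. -/
def IsSCC (C : Set V) : Prop := C.Nonempty ∧ ∃ u, C = G.cls u

/-- `C` is a strongly connected component on the set of vertices met by `X`. -/
def IsSCCOn (X : Set (List E)) (C : Set V) : Prop := G.IsSCC C ∧ C ⊆ G.vertsOf X

/-- The graph induced by a set of vertices. -/
def induce (U : Set V) : WeightedDigraph U {e : E // G.I e ∈ U ∧ G.O e ∈ U} where
  I e := ⟨G.I e.1, e.2.1⟩
  O e := ⟨G.O e.1, e.2.2⟩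
  W e := G.W e.1
  W_pos e := G.W_pos e.1

/-- A cycle: a strongly connected graph with all in-degrees and out-degrees equal to one. -/
def IsCycle : Prop :=
  (∀ u v, G.Conn u v) ∧
    ∀ v, {e | G.O e = v}.ncard = 1 ∧ {e | G.I e = v}.ncard = 1

/-- `p 1, p 2, …` is the sequence of weights of an infinite set `X` of paths: it lists the weights
of the paths in `X` in non-decreasing order, with one entry for each path. The value `p 0` plays
no role. -/
def IsSeqOfWeights (X : Set (List E)) (p : ℕ → ℝ) : Prop :=
  MonotoneOn p (Set.Ici 1) ∧
    ∃ x : ℕ → List E, Set.BijOn x (Set.Ici 1) X ∧ ∀ r, 1 ≤ r → p r = G.weight (x r)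

/-- The number of strongly connected components met by a path. -/
def numSCC (x : List E) : ℕ := {C | G.IsSCC C ∧ (C ∩ G.verts x).Nonempty}.ncard

/-! ### Itineraries -/

/-- The list of vertices along a path: the starting points of its edges, then its end point. -/
def vertexList (x : List E) : List V := x.map G.I ++ (x.getLast?.map G.O).toList

open scoped Classical in
/-- Replace `a b c` by `a c` wherever `a ↔ b ↔ c`, until no such triple is left. -/
def collapse : List V → List V
  | a :: b :: c :: l =>
    if G.Conn a b ∧ G.Conn b c then collapse (a :: c :: l) else a :: collapse (b :: c :: l)
  | [a, b] => [a, b]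
  | [a] => [a]
  | [] => []
termination_by l => l.length

/-- The itinerary of a path: for each strongly connected component in which the path has an edge,
only the entry and the exit vertices are kept. -/
def itin (x : List E) : List V := G.collapse (G.vertexList x)

/-- The pairs of consecutive vertices of a list. -/
def steps (σ : List V) : List (V × V) := σ.zip σ.tail

open scoped Classical in
/-- The steps `(a, b)` of an itinerary inside a strongly connected component (`a ↔ b`). -/
def innerSteps (σ : List V) : List (V × V) := (steps σ).filter (fun q => G.Conn q.1 q.2)

open scoped Classical in
/-- The other steps of an itinerary; a path makes each of them along one edge. -/
def outerSteps (σ : List V) : List (V × V) := (steps σ).filter (fun q => ¬ G.Conn q.1 q.2)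

open scoped Classical in
/-- The weight of one turn around a component `C` which is a cycle: such a path uses every edge of
`C` exactly once. -/
def cycleWeight [Fintype E] (C : Set V) : ℝ :=
  ∑ e with G.I e ∈ C ∧ G.O e ∈ C, G.W e

/-- For an itinerary with `k` inner steps, in components of cycle weights `w₁, …, wₖ`, the number
`k! * w₁ * ⋯ * wₖ`, which is the limit of `q r ^ k / r` for the composition `q` of the sequences of
weights of these components. -/
def itinValue [Fintype E] (σ : List V) : ℝ :=
  ((G.innerSteps σ).length.factorial : ℝ) *
    ((G.innerSteps σ).map (fun q => G.cycleWeight (G.cls q.1))).prod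

/-- The number of ways to choose an edge for every outer step of an itinerary. -/
def itinMult (σ : List V) : ℝ :=
  ((G.outerSteps σ).map (fun q => ({e | G.I e = q.1 ∧ G.O e = q.2}.ncard : ℝ))).prod

/-- The limit in the case that all components on the vertices met by `X` are cycles and `c` is the
greatest number of components met by a path in `X`: the harmonic sum of `itinValue` over the
itineraries of `X` with `c` inner steps, each counted `itinMult` times. -/
def cycleLimit [Fintype E] (X : Set (List E)) (c : ℕ) : ℝ :=
  (∑ᶠ σ ∈ {σ | σ ∈ G.itin '' X ∧ (G.innerSteps σ).length = c},
    G.itinMult σ / G.itinValue σ)⁻¹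

/-! ### The decay constant of a strongly connected graph -/

open scoped Classical in
/-- The matrix whose `(i, j)` entry is the sum of `exp (- W e / s)` over the edges `e` from `j`
to `i`. -/
def decayMatrix [Fintype E] (s : ℝ) : Matrix V V ℂ :=
  Matrix.of fun i j => ∑ e with G.I e = j ∧ G.O e = i, (Real.exp (-(s⁻¹ * G.W e)) : ℂ)

open scoped Classical in
/-- `s > 0` and the matrix `decayMatrix s` has spectral radius one. -/
def IsDecayConst [Fintype V] [Fintype E] (s : ℝ) : Prop :=
  0 < s ∧ spectralRadius ℂ (G.decayMatrix s) = 1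

open scoped Classical in
/-- `s` is the decay constant of the graph induced by `C`. -/
def IsDecayConstOf [Fintype V] [Fintype E] (C : Set V) (s : ℝ) : Prop :=
  (G.induce C).IsDecayConst s

end WeightedDigraph

end

noncomputable section

namespace WeightedDigraph

variable {V E : Type*} (G : WeightedDigraph V E)

/-! ### Walks -/

/-- `x` is a possibly empty list of consecutive edges leading from `u` to `v`. -/
def Walk : V → List E → V → Prop
  | u, [], v => u = v
  | u, e :: x, v => G.I e = u ∧ Walk (G.O e) x v

@[simp] theorem walk_nil {u v : V} : G.Walk u [] v ↔ u = v := Iff.rfl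

@[simp] theorem walk_cons {u v : V} {e : E} {x : List E} :
    G.Walk u (e :: x) v ↔ G.I e = u ∧ G.Walk (G.O e) x v := Iff.rfl

variable {G}

theorem walk_append {u v : V} {x y : List E} :
    G.Walk u (x ++ y) v ↔ ∃ a, G.Walk u x a ∧ G.Walk a y v := by
  induction x generalizing u with
  | nil => simp
  | cons e x ih => simp [ih, and_assoc]

theorem Walk.append {u a v : V} {x y : List E} (hx : G.Walk u x a) (hy : G.Walk a y v) :
    G.Walk u (x ++ y) v := walk_append.2 ⟨a, hx, hy⟩

theorem Walk.end_unique {u v v' : V} {x : List E} (h : G.Walk u x v) (h' : G.Walk u x v') :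
    v = v' := by
  induction x generalizing u with
  | nil => exact h.symm.trans h'
  | cons e x ih => exact ih h.2 h'.2

theorem walk_iff_isChain {u v : V} {e : E} {x : List E} :
    G.Walk u (e :: x) v ↔ G.I e = u ∧ (e :: x).IsChain (fun e f => G.I f = G.O e) ∧
      G.O ((e :: x).getLast (by simp)) = v := by
  induction x generalizing u e with
  | nil => simp
  | cons f x ih =>
    rw [walk_cons, ih]
    simp [List.isChain_cons_cons, and_assoc]

theorem mem_paths_iff {u v : V} {x : List E} : x ∈ G.paths u v ↔ x ≠ [] ∧ G.Walk u x v := by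
  cases x with
  | nil => simp [paths]
  | cons e x =>
    rw [walk_iff_isChain]
    simp [paths]
    tauto

theorem Walk.mem_paths {u v : V} {x : List E} (h : G.Walk u x v) (hx : x ≠ []) :
    x ∈ G.paths u v := mem_paths_iff.2 ⟨hx, h⟩

theorem paths_append {u a v : V} {x y : List E} (hx : x ∈ G.paths u a) (hy : G.Walk a y v) :
    x ++ y ∈ G.paths u v := by
  rw [mem_paths_iff] at *
  exact ⟨by simp [hx.1], hx.2.append hy⟩

theorem singleton_mem_paths (e : E) : [e] ∈ G.paths (G.I e) (G.O e) := by
  simp [mem_paths_iff]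

variable (G) in
@[simp] theorem weight_nil : G.weight [] = 0 := by simp [weight]

variable (G) in
@[simp] theorem weight_cons (e : E) (x : List E) : G.weight (e :: x) = G.W e + G.weight x := by
  simp [weight]

variable (G) in
@[simp] theorem weight_append (x y : List E) : G.weight (x ++ y) = G.weight x + G.weight y := by
  simp [weight]

variable (G) in
theorem weight_nonneg (x : List E) : 0 ≤ G.weight x := by
  induction x with
  | nil => simp
  | cons e x ih => have := G.W_pos e; simp; linarith

variable (G) in
theorem weight_pos {x : List E} (hx : x ≠ []) : 0 < G.weight x := by
  cases x with
  | nil => simp at hx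
  | cons e x => have := G.W_pos e; have := G.weight_nonneg x; simp; linarith

/-! ### Strong connectedness -/

theorem Conn.symm {u v : V} (h : G.Conn u v) : G.Conn v u := ⟨h.2, h.1⟩

theorem paths_nonempty_trans {u v w : V} (h : (G.paths u v).Nonempty)
    (h' : (G.paths v w).Nonempty) : (G.paths u w).Nonempty := by
  obtain ⟨x, hx⟩ := h
  obtain ⟨y, hy⟩ := h'
  exact ⟨_, paths_append hx (mem_paths_iff.1 hy).2⟩

theorem Conn.trans {u v w : V} (h : G.Conn u v) (h' : G.Conn v w) : G.Conn u w :=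
  ⟨paths_nonempty_trans h.1 h'.1, paths_nonempty_trans h'.2 h.2⟩

theorem Conn.left {u v : V} (h : G.Conn u v) : G.Conn u u := h.trans h.symm

theorem Conn.right {u v : V} (h : G.Conn u v) : G.Conn v v := h.symm.trans h

theorem mem_cls {u v : V} : v ∈ G.cls u ↔ G.Conn u v := Iff.rfl

theorem Conn.cls_eq {u v : V} (h : G.Conn u v) : G.cls u = G.cls v :=
  Set.ext fun _ => ⟨fun h' => h.symm.trans h', fun h' => h.trans h'⟩

theorem Conn.isSCC {u v : V} (h : G.Conn u v) : G.IsSCC (G.cls u) := ⟨⟨v, h⟩, u, rfl⟩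

theorem IsSCC.eq_cls {C : Set V} (hC : G.IsSCC C) {a : V} (ha : a ∈ C) : C = G.cls a := by
  obtain ⟨-, u, rfl⟩ := hC
  exact Conn.cls_eq ha

theorem IsSCC.conn {C : Set V} (hC : G.IsSCC C) {a b : V} (ha : a ∈ C) (hb : b ∈ C) :
    G.Conn a b := by
  rw [hC.eq_cls ha] at hb
  exact hb

theorem Walk.paths_nonempty {u a v : V} {x : List E} (h : G.Walk u x a)
    (h' : (G.paths a v).Nonempty) : (G.paths u v).Nonempty := by
  by_cases hx : x = []
  · subst hx; rw [walk_nil] at h; subst h; exact h'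
  · exact paths_nonempty_trans ⟨x, h.mem_paths hx⟩ h'

theorem Walk.paths_nonempty' {u a v : V} {x : List E} (h : G.Walk a x v)
    (h' : (G.paths u a).Nonempty) : (G.paths u v).Nonempty := by
  obtain ⟨y, hy⟩ := h'
  exact ⟨_, paths_append hy h⟩

/-- A vertex on a walk between connected vertices is connected with both of them. -/
theorem Conn.of_walks {u a v : V} {x y : List E} (h : G.Conn u v) (hx : G.Walk u x a)
    (hy : G.Walk a y v) : G.Conn u a :=
  ⟨hx.paths_nonempty' h.left.1, hy.paths_nonempty h.2⟩

theorem exists_split {u v : V} {x : List E} (h : G.Walk u x v) {e : E} (he : e ∈ x) :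
    ∃ y z, x = y ++ e :: z ∧ G.Walk u y (G.I e) ∧ G.Walk (G.O e) z v := by
  obtain ⟨y, z, rfl⟩ := List.append_of_mem he
  obtain ⟨a, h1, h2, h3⟩ := walk_append.1 h
  subst h2
  exact ⟨y, z, rfl, h1, h3⟩

theorem exists_split_of_mem_verts {u v a : V} {x : List E} (h : G.Walk u x v)
    (ha : a ∈ G.verts x) : ∃ y z, x = y ++ z ∧ G.Walk u y a ∧ G.Walk a z v := by
  obtain ⟨e, he, rfl | rfl⟩ := ha
  · obtain ⟨y, z, rfl, h1, h2⟩ := exists_split h he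
    exact ⟨y, e :: z, rfl, h1, by simpa using h2⟩
  · obtain ⟨y, z, rfl, h1, h2⟩ := exists_split h he
    exact ⟨y ++ [e], z, by simp, h1.append (by simp), h2⟩

theorem mem_vertsOf_paths_iff {u v a : V} : a ∈ G.vertsOf (G.paths u v) ↔
    ∃ y z, y ++ z ≠ [] ∧ G.Walk u y a ∧ G.Walk a z v := by
  constructor
  · rintro ⟨x, hx, ha⟩
    rw [mem_paths_iff] at hx
    obtain ⟨y, z, rfl, h1, h2⟩ := exists_split_of_mem_verts hx.2 ha
    exact ⟨y, z, hx.1, h1, h2⟩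
  · rintro ⟨y, z, h, h1, h2⟩
    refine ⟨y ++ z, (h1.append h2).mem_paths h, ?_⟩
    cases z with
    | cons e z => exact ⟨e, by simp, Or.inl h2.1.symm⟩
    | nil =>
      rw [walk_nil] at h2
      subst h2
      obtain ⟨y, e, rfl⟩ := y.eq_nil_or_concat.resolve_left (by simpa using h)
      rw [List.concat_eq_append, walk_append] at h1
      obtain ⟨b, -, -, h3⟩ := h1
      exact ⟨e, by simp, Or.inr h3.symm⟩

theorem cls_subset_vertsOf {u v a : V} (h : a ∈ G.vertsOf (G.paths u v)) :
    G.cls a ⊆ G.vertsOf (G.paths u v) := by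
  intro b hb
  rw [mem_vertsOf_paths_iff] at *
  obtain ⟨y, z, -, h1, h2⟩ := h
  obtain ⟨⟨p, hp⟩, q, hq⟩ := hb
  rw [mem_paths_iff] at hp hq
  exact ⟨y ++ p, q ++ z, by simp [hp.1], h1.append hp.2, hq.2.append h2⟩

theorem Conn.isSCCOn {u v a b : V} (h : G.Conn a b) (ha : a ∈ G.vertsOf (G.paths u v)) :
    G.IsSCCOn (G.paths u v) (G.cls a) := ⟨h.isSCC, cls_subset_vertsOf ha⟩

/-! ### Lists of bounded weight -/

theorem finite_weight_le [Finite E] (t : ℝ) : {x : List E | G.weight x ≤ t}.Finite := by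
  cases isEmpty_or_nonempty E with
  | inl _ => exact Set.toFinite _
  | inr _ =>
    obtain ⟨e, he⟩ := Finite.exists_min G.W
    refine (List.finite_length_le E ⌊t / G.W e⌋₊).subset fun x hx => Nat.le_floor ?_
    rw [le_div_iff₀ (G.W_pos e)]
    refine le_trans ?_ hx
    clear hx
    induction x with
    | nil => simp
    | cons f x ih => have := he f; push_cast [List.length_cons]; simp; linarith

end WeightedDigraph
end

noncomputable section

/-! ### Growth of functions satisfying a difference equation -/

theorem pow_succ_add_le_add_pow {x w : ℝ} (hx : 0 ≤ x) (hxw : 0 ≤ x + w) (n : ℕ) :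
    x ^ (n + 1) + (n + 1) * w * x ^ n ≤ (x + w) ^ (n + 1) := by
  induction n with
  | zero => simp
  | succ n ih =>
    have h := mul_le_mul_of_nonneg_left ih hxw
    have h2 : 0 ≤ (n + 1) * w ^ 2 * x ^ n := by positivity
    calc x ^ (n + 1 + 1) + ((n + 1 : ℕ) + 1) * w * x ^ (n + 1)
        ≤ (x + w) * (x ^ (n + 1) + (n + 1) * w * x ^ n) := by
          push_cast; ring_nf at h2 ⊢; linarith
      _ ≤ _ := by rw [pow_succ' (x + w)]; exact h

theorem tendsto_shift_div_pow {f : ℝ → ℝ} {k : ℕ} {L : ℝ}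
    (h : Tendsto (fun t => f t / t ^ k) atTop (𝓝 L)) (w : ℝ) :
    Tendsto (fun t => f (t - w) / t ^ k) atTop (𝓝 L) := by
  have h1 : Tendsto (fun t : ℝ => t - w) atTop atTop := tendsto_atTop_add_const_right _ (-w) tendsto_id
  have h2 : Tendsto (fun t : ℝ => 1 - w / t) atTop (𝓝 1) := by
    simpa using (tendsto_const_nhds (x := (1 : ℝ))).sub (tendsto_const_nhds.div_atTop tendsto_id)
  have h3 := (h.comp h1).mul (h2.pow k)
  simp only [one_pow, mul_one] at h3
  refine h3.congr' ?_
  filter_upwards [eventually_gt_atTop 0, eventually_gt_atTop w] with t ht htw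
  have : t - w ≠ 0 := by linarith
  have h4 : 1 - w / t = (t - w) / t := by field_simp
  simp only [Function.comp, h4, div_pow]
  field_simp

theorem induction_step {w : ℝ} (hw : 0 < w) {P : ℝ → Prop} (h0 : ∀ t < 0, P t)
    (h : ∀ t, 0 ≤ t → P (t - w) → P t) (t : ℝ) : P t := by
  obtain ⟨n, hn⟩ := exists_nat_gt (t / w)
  rw [div_lt_iff₀ hw] at hn
  induction n generalizing t with
  | zero => exact h0 t (by simpa using hn)
  | succ n ih =>
    rcases lt_or_ge t 0 with ht | ht
    · exact h0 t ht
    · refine h t ht (ih _ ?_)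
      push_cast at hn
      linarith

theorem tendsto_of_difference {f g : ℝ → ℝ} {k : ℕ} {L w : ℝ} (hw : 0 < w)
    (hfg : ∀ t, f t = g t + f (t - w)) (hneg : ∀ t < 0, f t = 0) (hmono : Monotone f)
    (hg : Tendsto (fun t => g t / t ^ k) atTop (𝓝 L)) :
    Tendsto (fun t => f t / t ^ (k + 1)) atTop (𝓝 (L / ((k + 1) * w))) := by
  have hf0 : ∀ t, 0 ≤ f t := fun t => by
    rw [← hneg (min t 0 - 1) (by have := min_le_right t 0; linarith)]
    exact hmono (by have := min_le_left t 0; linarith)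
  have hL : 0 ≤ L := by
    refine ge_of_tendsto hg ?_
    filter_upwards [eventually_gt_atTop 0] with t ht
    have h1 : 0 ≤ g t := by
      have := hmono (show t - w ≤ t by linarith)
      rw [hfg t] at this
      linarith
    positivity
  have hk : (0 : ℝ) < (k + 1) * w := by positivity
  rw [tendsto_order]
  constructor
  · intro b hb
    rcases lt_or_ge b 0 with hb0 | hb0
    · filter_upwards [eventually_gt_atTop 0] with t ht
      have := hf0 t
      exact hb0.trans_le (by positivity)
    obtain ⟨a, hab, haL⟩ := exists_between ((lt_div_iff₀ hk).1 hb)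
    have ha0 : 0 ≤ a := le_trans (by positivity) hab.le
    obtain ⟨T, hT⟩ := eventually_atTop.1 ((hg.eventually_const_lt haL).and
      ((eventually_gt_atTop 0).and (eventually_ge_atTop w)))
    have key : ∀ t, 0 ≤ t → a * t ^ (k + 1) / ((k + 1) * w) - a * (max T 0) ^ (k + 1) / ((k + 1) * w)
        ≤ f t := by
      refine induction_step hw (fun t ht ht' => absurd ht' (by linarith)) fun t ht ih _ => ?_
      rcases le_or_gt t (max T 0) with htT | htT
      · refine le_trans ?_ (hf0 t)
        rw [sub_nonpos]
        gcongr
      · obtain ⟨h1, h2, h3⟩ := hT t ((le_max_left _ _).trans htT.le)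
        rw [lt_div_iff₀ (by positivity)] at h1
        have h4 := ih (by linarith)
        have h5 := pow_succ_add_le_add_pow ht (w := -w) (by linarith) k
        rw [← sub_eq_add_neg] at h5
        have h6 : a * t ^ (k + 1) / ((k + 1) * w)
            ≤ a * (t - w) ^ (k + 1) / ((k + 1) * w) + a * t ^ k := by
          rw [div_add' _ _ _ hk.ne', div_le_div_iff_of_pos_right hk]
          have := mul_le_mul_of_nonneg_left h5 ha0
          linarith
        rw [hfg t]
        linarith
    have hlim : Tendsto (fun t : ℝ => a / ((k + 1) * w)
        - (a * (max T 0) ^ (k + 1) / ((k + 1) * w)) / t ^ (k + 1)) atTop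
        (𝓝 (a / ((k + 1) * w) - 0)) :=
      tendsto_const_nhds.sub (tendsto_const_nhds.div_atTop (tendsto_pow_atTop (by omega)))
    rw [sub_zero] at hlim
    filter_upwards [hlim.eventually_const_lt ((lt_div_iff₀ hk).2 hab), eventually_gt_atTop 0]
      with t h1 h2
    refine h1.trans_le ?_
    rw [le_div_iff₀ (by positivity)]
    refine le_trans (le_of_eq ?_) (key t h2.le)
    field_simp
  · intro b hb
    obtain ⟨a, haL, hab⟩ := exists_between ((div_lt_iff₀ hk).1 hb)
    have ha0 : 0 ≤ a := hL.trans haL.le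
    obtain ⟨T, hT⟩ := eventually_atTop.1 ((hg.eventually_lt_const haL).and
      (eventually_gt_atTop 0))
    have key : ∀ t, -w ≤ t → f t ≤ a * (t + w) ^ (k + 1) / ((k + 1) * w) + f T := by
      refine induction_step hw (fun t ht ht' => ?_) fun t ht ih _ => ?_
      · rw [hneg t ht]
        have := hf0 T
        have : 0 ≤ t + w := by linarith
        positivity
      · rcases le_or_gt t T with htT | htT
        · have := hmono htT
          have : 0 ≤ a * (t + w) ^ (k + 1) / ((k + 1) * w) := by positivity
          linarith
        · obtain ⟨h1, h2⟩ := hT t htT.le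
          rw [div_lt_iff₀ (by positivity)] at h1
          have h4 := ih (by linarith)
          rw [sub_add_cancel] at h4
          have h5 := pow_succ_add_le_add_pow ht (w := w) (by linarith) k
          have h6 : a * t ^ (k + 1) / ((k + 1) * w) + a * t ^ k
              ≤ a * (t + w) ^ (k + 1) / ((k + 1) * w) := by
            rw [div_add' _ _ _ hk.ne', div_le_div_iff_of_pos_right hk]
            have := mul_le_mul_of_nonneg_left h5 ha0
            linarith
          rw [hfg t]
          linarith
    have h1 : Tendsto (fun t : ℝ => 1 + w / t) atTop (𝓝 1) := by
      simpa using (tendsto_const_nhds (x := (1 : ℝ))).add (tendsto_const_nhds.div_atTop tendsto_id)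
    have hlim : Tendsto (fun t : ℝ => a / ((k + 1) * w) * (1 + w / t) ^ (k + 1)
        + f T / t ^ (k + 1)) atTop (𝓝 (a / ((k + 1) * w) * 1 ^ (k + 1) + 0)) :=
      (tendsto_const_nhds.mul (h1.pow _)).add
        (tendsto_const_nhds.div_atTop (tendsto_pow_atTop (by omega)))
    rw [add_zero, one_pow, mul_one] at hlim
    filter_upwards [hlim.eventually_lt_const ((div_lt_iff₀ hk).2 hab), eventually_gt_atTop 0]
      with t h1 h2
    refine lt_of_le_of_lt ?_ h1
    rw [div_le_iff₀ (by positivity)]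
    refine le_trans (key t (by linarith)) (le_of_eq ?_)
    have : 1 + w / t = (t + w) / t := by field_simp
    rw [this, div_pow]
    field_simp

theorem tendsto_div_pow_of_lt {f : ℝ → ℝ} {k c : ℕ} {L : ℝ} (hkc : k < c)
    (h : Tendsto (fun t => f t / t ^ k) atTop (𝓝 L)) :
    Tendsto (fun t => f t / t ^ c) atTop (𝓝 0) := by
  refine (h.div_atTop (tendsto_pow_atTop (n := c - k) (by omega))).congr fun t => ?_
  rw [div_div, ← pow_add, Nat.add_sub_cancel' hkc.le]

namespace WeightedDigraph

variable {V E : Type*} (G : WeightedDigraph V E)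

/-- The number of elements of `S` of weight at most `t`. -/
def count (S : Set (List E)) (t : ℝ) : ℕ := {x | x ∈ S ∧ G.weight x ≤ t}.ncard

variable {G}

theorem finite_count [Finite E] (S : Set (List E)) (t : ℝ) :
    {x | x ∈ S ∧ G.weight x ≤ t}.Finite :=
  (finite_weight_le t).subset fun _ h => h.2

theorem count_mono_set [Finite E] {S S' : Set (List E)} (h : S ⊆ S') (t : ℝ) :
    G.count S t ≤ G.count S' t :=
  Set.ncard_le_ncard (fun _ hx => ⟨h hx.1, hx.2⟩) (finite_count _ _)

theorem count_mono [Finite E] (S : Set (List E)) : Monotone (G.count S) := fun _ _ h =>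
  Set.ncard_le_ncard (fun _ hx => ⟨hx.1, hx.2.trans h⟩) (finite_count _ _)

theorem count_of_neg (S : Set (List E)) {t : ℝ} (ht : t < 0) : G.count S t = 0 := by
  have : {x | x ∈ S ∧ G.weight x ≤ t} = ∅ :=
    Set.eq_empty_of_forall_notMem fun x hx => by have := G.weight_nonneg x; linarith [hx.2]
  rw [count, this, Set.ncard_empty]

theorem count_union [Finite E] {S S' : Set (List E)} (h : Disjoint S S') (t : ℝ) :
    G.count (S ∪ S') t = G.count S t + G.count S' t := by
  rw [count, count, count, ← Set.ncard_union_eq ?_ (finite_count _ _) (finite_count _ _)]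
  · congr 1; ext x; simp [or_and_right]
  · rw [Set.disjoint_left] at *
    exact fun x hx hx' => h hx.1 hx'.1

theorem count_biUnion [Finite E] {ι : Type*} (s : Finset ι) (S : ι → Set (List E))
    (h : ∀ i ∈ s, ∀ j ∈ s, i ≠ j → Disjoint (S i) (S j)) (t : ℝ) :
    G.count (⋃ i ∈ s, S i) t = ∑ i ∈ s, G.count (S i) t := by
  classical
  induction s using Finset.induction_on with
  | empty => simp [count]
  | insert i s hi ih =>
    rw [Finset.set_biUnion_insert, count_union, Finset.sum_insert hi, ih]
    · exact fun a ha b hb => h a (Finset.mem_insert_of_mem ha) b (Finset.mem_insert_of_mem hb)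
    · rw [Set.disjoint_iUnion₂_right]
      intro j hj
      exact h i (Finset.mem_insert_self _ _) j (Finset.mem_insert_of_mem hj)
        (fun hij => hi (hij ▸ hj))

theorem count_image_append (x₀ : List E) (S : Set (List E)) (t : ℝ) :
    G.count ((x₀ ++ ·) '' S) t = G.count S (t - G.weight x₀) := by
  have : {x | x ∈ (x₀ ++ ·) '' S ∧ G.weight x ≤ t}
      = (x₀ ++ ·) '' {x | x ∈ S ∧ G.weight x ≤ t - G.weight x₀} := by
    ext x
    constructor
    · rintro ⟨⟨y, hy, rfl⟩, h⟩
      refine ⟨y, ⟨hy, ?_⟩, rfl⟩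
      simp only [weight_append] at h
      linarith
    · rintro ⟨y, ⟨hy, h⟩, rfl⟩
      refine ⟨⟨y, hy, rfl⟩, ?_⟩
      simp only [weight_append]
      linarith
  rw [count, count, this, Set.ncard_image_of_injective _ (List.append_right_injective x₀)]

variable (G) in
/-- The number of elements of `S` of weight at most `t` is asymptotically `L * t ^ k`. -/
def Growth (S : Set (List E)) (k : ℕ) (L : ℝ) : Prop :=
  Tendsto (fun t => (G.count S t : ℝ) / t ^ k) atTop (𝓝 L)

theorem Growth.image_append {S : Set (List E)} {k : ℕ} {L : ℝ} (h : G.Growth S k L)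
    (x₀ : List E) : G.Growth ((x₀ ++ ·) '' S) k L := by
  unfold Growth
  simp only [count_image_append]
  exact tendsto_shift_div_pow h _

theorem Growth.biUnion [Finite E] {ι : Type*} {s : Finset ι} {S : ι → Set (List E)} {k : ℕ}
    {L : ι → ℝ} (h : ∀ i ∈ s, ∀ j ∈ s, i ≠ j → Disjoint (S i) (S j))
    (hS : ∀ i ∈ s, G.Growth (S i) k (L i)) :
    G.Growth (⋃ i ∈ s, S i) k (∑ i ∈ s, L i) := by
  unfold Growth
  simp only [count_biUnion s S h, Nat.cast_sum, Finset.sum_div]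
  exact tendsto_finsetSum s hS

theorem Growth.of_lt {S : Set (List E)} {k c : ℕ} {L : ℝ} (h : G.Growth S k L) (hkc : k < c) :
    G.Growth S c 0 := tendsto_div_pow_of_lt hkc h

theorem growth_singleton_nil : G.Growth {[]} 0 1 := by
  refine tendsto_const_nhds.congr' ?_
  filter_upwards [eventually_ge_atTop 0] with t ht
  have : {x : List E | x ∈ ({[]} : Set (List E)) ∧ G.weight x ≤ t} = {[]} := by
    ext x
    constructor
    · exact fun h => h.1
    · rintro rfl; exact ⟨rfl, by simpa using ht⟩
  rw [count, this]
  simp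

/-- The growth of a set of lists obtained from `S` by prepending powers of the list `l`. -/
theorem Growth.of_eq_union [Finite E] {S T : Set (List E)} {l : List E} {k : ℕ} {L : ℝ}
    (h : G.Growth S k L) (hl : l ≠ []) (hT : T = S ∪ (l ++ ·) '' T)
    (hd : Disjoint S ((l ++ ·) '' T)) : G.Growth T (k + 1) (L / ((k + 1) * G.weight l)) := by
  refine tendsto_of_difference (G.weight_pos hl) (fun t => ?_) (fun t ht => ?_) ?_ h
  · rw [← count_image_append, ← Nat.cast_add, ← count_union hd, ← hT]
  · rw [count_of_neg _ ht, Nat.cast_zero]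
  · exact fun a b hab => by exact_mod_cast count_mono T hab

end WeightedDigraph
end

noncomputable section

namespace WeightedDigraph

variable {V E : Type*} {G : WeightedDigraph V E}

/-! ### The sequence of weights -/

theorem exists_monotone_bijective {A : Type*} [Countable A] [Infinite A] (f : A → ℝ)
    (hf : ∀ t, {a | f a ≤ t}.Finite) : ∃ x : ℕ → A, Function.Bijective x ∧ Monotone (f ∘ x) := by
  have := Encodable.ofCountable A
  let κ : A → ℝ ×ₗ ℕ := fun a => toLex (f a, Encodable.encode a)
  have hκ : Function.Injective κ := fun a b h => Encodable.encode_injective (congrArg (·.2) h)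
  let : LinearOrder A := LinearOrder.lift' κ hκ
  have hle : ∀ {a b : A}, a ≤ b → f a ≤ f b := by
    intro a b h
    have h' : κ a ≤ κ b := h
    rw [Prod.Lex.le_iff] at h'
    rcases h' with h' | h'
    · exact le_of_lt h'
    · exact le_of_eq h'.1
  have hfin : ∀ a : A, (Set.Iic a).Finite := fun a => (hf (f a)).subset fun _ h => hle h
  let : LocallyFiniteOrder A := LocallyFiniteOrder.ofFiniteIcc fun a b =>
    (hfin b).subset Set.Icc_subset_Iic_self
  have : NoMaxOrder A := ⟨fun a => by
    obtain ⟨b, hb⟩ := (hfin a).infinite_compl.nonempty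
    exact ⟨b, not_le.1 hb⟩⟩
  obtain ⟨a₀⟩ : Nonempty A := inferInstance
  obtain ⟨m, -, hm⟩ := Set.exists_min_image (Set.Iic a₀) id (hfin a₀) ⟨a₀, le_refl a₀⟩
  let : OrderBot A :=
    { bot := m
      bot_le := fun a => (le_total a a₀).elim (hm a) (fun h => (hm a₀ (le_refl a₀)).trans h) }
  let := LinearLocallyFiniteOrder.succOrder A
  let := LinearLocallyFiniteOrder.predOrder A
  let e : A ≃o ℕ := orderIsoNatOfLinearSuccPredArch
  exact ⟨e.symm, e.symm.bijective, fun i j h => hle (e.symm.monotone h)⟩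

theorem exists_isSeqOfWeights [Finite E] {X : Set (List E)} (hX : X.Infinite) :
    ∃ p, G.IsSeqOfWeights X p := by
  have := hX.to_subtype
  obtain ⟨x, hx, hm⟩ := exists_monotone_bijective (fun a : X => G.weight a.1) fun t =>
    Set.Finite.preimage Subtype.val_injective.injOn (finite_weight_le t)
  refine ⟨fun r => G.weight (x (r - 1)), fun a _ b _ hab => hm (Nat.sub_le_sub_right hab 1),
    fun r => (x (r - 1)).1, ⟨fun r _ => (x (r - 1)).2, fun a ha b hb hab => ?_, fun y hy => ?_⟩,
    fun r _ => rfl⟩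
  · have := hx.1 (Subtype.ext hab)
    rw [Set.mem_Ici] at ha hb
    omega
  · obtain ⟨r, hr⟩ := hx.2 ⟨y, hy⟩
    exact ⟨r + 1, by simp, by simp [hr]⟩

variable {X : Set (List E)} {p : ℕ → ℝ}

theorem IsSeqOfWeights.le_count [Finite E] (hp : G.IsSeqOfWeights X p) {r : ℕ} (hr : 1 ≤ r) :
    r ≤ G.count X (p r) := by
  obtain ⟨hm, x, hx, hpx⟩ := hp
  have hsub : Set.Icc 1 r ⊆ Set.Ici 1 := Set.Icc_subset_Ici_self
  have h : (x '' Set.Icc 1 r).ncard = r := by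
    rw [(hx.injOn.mono hsub).ncard_image]
    simp [← Finset.coe_Icc, Set.ncard_coe_finset]
  conv_lhs => rw [← h]
  refine Set.ncard_le_ncard ?_ (finite_count _ _)
  rintro _ ⟨i, hi, rfl⟩
  exact ⟨hx.mapsTo (hsub hi), hpx i hi.1 ▸ hm hi.1 hr hi.2⟩

theorem IsSeqOfWeights.count_lt [Finite E] (hp : G.IsSeqOfWeights X p) {r : ℕ} (hr : 1 ≤ r)
    {t : ℝ} (ht : t < p r) : G.count X t < r := by
  obtain ⟨hm, x, hx, hpx⟩ := hp
  have h : {y | y ∈ X ∧ G.weight y ≤ t} ⊆ x '' Set.Ico 1 r := by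
    rintro y ⟨hy, hyt⟩
    obtain ⟨i, hi, rfl⟩ := hx.surjOn hy
    refine ⟨i, ⟨hi, ?_⟩, rfl⟩
    by_contra! hri
    have := hm hr hi hri
    rw [hpx i hi] at this
    linarith
  have h1 := Set.ncard_le_ncard h (Set.Finite.image _ (Set.finite_Ico _ _))
  have h2 := Set.ncard_image_le (f := x) (Set.finite_Ico 1 r)
  have h3 : (Set.Ico 1 r).ncard = r - 1 := by
    simp [← Finset.coe_Ico, Set.ncard_coe_finset]
  unfold count
  omega

theorem IsSeqOfWeights.tendsto_atTop [Finite E] (hp : G.IsSeqOfWeights X p) :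
    Tendsto p atTop atTop := by
  refine Filter.tendsto_atTop.2 fun t => ?_
  filter_upwards [eventually_ge_atTop 1, eventually_gt_atTop (G.count X t)] with r hr hrt
  by_contra! h
  have := hp.le_count hr
  have := count_mono (G := G) X h.le
  omega

theorem IsSeqOfWeights.tendsto_pow_div [Finite E] (hp : G.IsSeqOfWeights X p) {c : ℕ} {L : ℝ}
    (hL : 0 < L) (hX : G.Growth X c L) :
    Tendsto (fun r : ℕ => p r ^ c / (r : ℝ)) atTop (𝓝 L⁻¹) := by
  have h : Tendsto (fun r : ℕ => (r : ℝ) / p r ^ c) atTop (𝓝 L) := by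
    refine tendsto_of_tendsto_of_tendsto_of_le_of_le'
      ((tendsto_shift_div_pow hX 1).comp hp.tendsto_atTop) (hX.comp hp.tendsto_atTop) ?_ ?_
    · filter_upwards [eventually_ge_atTop 1, hp.tendsto_atTop.eventually_gt_atTop 0] with r hr hp0
      have := (hp.count_lt hr (sub_one_lt (p r))).le
      simp only [Function.comp]
      gcongr
    · filter_upwards [eventually_ge_atTop 1, hp.tendsto_atTop.eventually_gt_atTop 0] with r hr hp0
      have := hp.le_count hr
      simp only [Function.comp]
      gcongr
  refine (h.inv₀ hL.ne').congr fun r => ?_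
  rw [inv_div]

theorem IsSeqOfWeights.tendsto_div_log [Finite E] (hp : G.IsSeqOfWeights X p) {s : ℝ}
    (hs : 0 < s)
    (hupper : ∀ l, s⁻¹ < l → ∃ K : ℝ, ∀ t, (G.count X t : ℝ) ≤ K * Real.exp (l * t))
    (hlower : ∀ l, 0 < l → l < s⁻¹ →
      ∃ K : ℝ, 0 < K ∧ ∀ᶠ t in atTop, K * Real.exp (l * t) ≤ G.count X t) :
    Tendsto (fun r : ℕ => p r / Real.log (r : ℝ)) atTop (𝓝 s) := by
  have hs' : 0 < s⁻¹ := inv_pos.2 hs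
  have h : Tendsto (fun r : ℕ => Real.log r / p r) atTop (𝓝 s⁻¹) := by
    have hlim : ∀ a b : ℝ, Tendsto (fun r : ℕ => a + b / p r) atTop (𝓝 a) := fun a b => by
      simpa using (tendsto_const_nhds (x := a)).add (tendsto_const_nhds.div_atTop hp.tendsto_atTop)
    rw [tendsto_order]
    constructor
    · intro b hb
      obtain ⟨l, hbl, hl⟩ := exists_between (max_lt hb hs')
      obtain ⟨K, hK, hKt⟩ := hlower l ((le_max_right _ _).trans_lt hbl) hl
      have h1 : Tendsto (fun r => p r - 1) atTop atTop :=
        tendsto_atTop_add_const_right _ (-1) hp.tendsto_atTop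
      filter_upwards [eventually_ge_atTop 1, hp.tendsto_atTop.eventually_gt_atTop 0,
        h1.eventually hKt, (hlim l (Real.log K - l)).eventually_const_lt
          ((le_max_left _ _).trans_lt hbl)] with r hr hp0 hr1 hr2
      refine hr2.trans_le ?_
      have h3 : K * Real.exp (l * (p r - 1)) ≤ r :=
        hr1.trans (by exact_mod_cast (hp.count_lt hr (sub_one_lt (p r))).le)
      have h4 := Real.log_le_log (by positivity) h3
      rw [Real.log_mul hK.ne' (Real.exp_pos _).ne', Real.log_exp] at h4
      rw [le_div_iff₀ hp0, add_mul, div_mul_cancel₀ _ hp0.ne']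
      linarith
    · intro b hb
      obtain ⟨l, hl, hlb⟩ := exists_between hb
      obtain ⟨K, hK⟩ := hupper l hl
      filter_upwards [eventually_ge_atTop 1, hp.tendsto_atTop.eventually_gt_atTop 0,
        (hlim l (Real.log K)).eventually_lt_const hlb] with r hr hp0 hr1
      refine lt_of_le_of_lt ?_ hr1
      have hr0 : (0 : ℝ) < r := by exact_mod_cast hr
      have h3 : (r : ℝ) ≤ K * Real.exp (l * p r) :=
        le_trans (by exact_mod_cast hp.le_count hr) (hK _)
      have hK0 : 0 < K := by
        have := hr0.trans_le h3
        exact pos_of_mul_pos_left this (Real.exp_pos _).le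
      have h4 := Real.log_le_log hr0 h3
      rw [Real.log_mul hK0.ne' (Real.exp_pos _).ne', Real.log_exp] at h4
      rw [div_le_iff₀ hp0, add_mul, div_mul_cancel₀ _ hp0.ne']
      linarith
  have h2 := h.inv₀ hs'.ne'
  rw [inv_inv] at h2
  refine h2.congr fun r => ?_
  rw [inv_div]

theorem infinite_of_count_unbounded [Finite E] (h : ∀ n : ℕ, ∃ t, n < G.count X t) :
    X.Infinite := by
  intro hX
  obtain ⟨t, ht⟩ := h X.ncard
  exact absurd (Set.ncard_le_ncard (fun x hx => hx.1 : {x | x ∈ X ∧ G.weight x ≤ t} ⊆ X) hX)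
    (not_le.2 ht)

theorem Growth.infinite [Finite E] {c : ℕ} {L : ℝ} (h : G.Growth X c L) (hc : 1 ≤ c)
    (hL : 0 < L) : X.Infinite := by
  refine infinite_of_count_unbounded (G := G) fun n => ?_
  have h1 : Tendsto (fun t : ℝ => (n : ℝ) / t ^ c) atTop (𝓝 0) :=
    tendsto_const_nhds.div_atTop (tendsto_pow_atTop (by omega))
  obtain ⟨t, ht, ht0⟩ := ((h1.eventually_lt h hL).and (eventually_gt_atTop 0)).exists
  rw [div_lt_div_iff_of_pos_right (by positivity)] at ht
  exact ⟨t, by exact_mod_cast ht⟩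

end WeightedDigraph
end

noncomputable section

namespace WeightedDigraph

variable {V E : Type*} (G : WeightedDigraph V E)

/-! ### Itineraries -/

open scoped Classical in
/-- The walks with a given itinerary: an outer step is made along an edge, an inner step along
an arbitrary path. -/
def along : List V → Set (List E)
  | a :: b :: l =>
    if G.Conn a b then {x | ∃ y ∈ G.paths a b, ∃ z ∈ along (b :: l), x = y ++ z}
    else {x | ∃ e, G.I e = a ∧ G.O e = b ∧ ∃ z ∈ along (b :: l), x = e :: z}
  | _ => {[]}

variable {G}

theorem along_singleton (a : V) : G.along [a] = {[]} := by rw [along]; simp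

theorem along_of_conn {a b : V} (h : G.Conn a b) (l : List V) : G.along (a :: b :: l) =
    {x | ∃ y ∈ G.paths a b, ∃ z ∈ G.along (b :: l), x = y ++ z} := by
  rw [along, if_pos h]

theorem along_of_not_conn {a b : V} (h : ¬ G.Conn a b) (l : List V) : G.along (a :: b :: l) =
    {x | ∃ e, G.I e = a ∧ G.O e = b ∧ ∃ z ∈ G.along (b :: l), x = e :: z} := by
  rw [along, if_neg h]

theorem collapse_of_conn {a b c : V} (h : G.Conn a b) (h' : G.Conn b c) (l : List V) :
    G.collapse (a :: b :: c :: l) = G.collapse (a :: c :: l) := by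
  rw [collapse, if_pos ⟨h, h'⟩]

theorem collapse_of_not {a b c : V} (h : ¬ (G.Conn a b ∧ G.Conn b c)) (l : List V) :
    G.collapse (a :: b :: c :: l) = a :: G.collapse (b :: c :: l) := by
  rw [collapse, if_neg h]

@[simp] theorem collapse_pair (a b : V) : G.collapse [a, b] = [a, b] := by rw [collapse]

@[simp] theorem collapse_singleton (a : V) : G.collapse [a] = [a] := by rw [collapse]

theorem exists_collapse_cons (a : V) (l : List V) : ∃ l', G.collapse (a :: l) = a :: l' := by
  induction l generalizing a with
  | nil => exact ⟨[], by simp⟩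
  | cons b l ih =>
    cases l with
    | nil => exact ⟨[b], by simp⟩
    | cons c l =>
      by_cases h : G.Conn a b ∧ G.Conn b c
      · rw [collapse_of_conn h.1 h.2]
        clear ih
        induction l generalizing a b c with
        | nil => exact ⟨[c], by simp⟩
        | cons d l ih' =>
          by_cases h' : G.Conn a c ∧ G.Conn c d
          · rw [collapse_of_conn h'.1 h'.2]
            exact ih' _ _ _ h'
          · rw [collapse_of_not h']
            exact ⟨_, rfl⟩
      · rw [collapse_of_not h]
        exact ⟨_, rfl⟩

theorem exists_collapse_cons_cons (a b : V) (l : List V) :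
    ∃ c l', G.collapse (a :: b :: l) = a :: c :: l' ∧ (c = b ∨ G.Conn a b) := by
  induction l generalizing b with
  | nil => exact ⟨b, [], by simp⟩
  | cons c l ih =>
    by_cases h : G.Conn a b ∧ G.Conn b c
    · rw [collapse_of_conn h.1 h.2]
      obtain ⟨d, l', h1, -⟩ := ih c
      exact ⟨d, l', h1, Or.inr h.1⟩
    · rw [collapse_of_not h]
      obtain ⟨l', hl'⟩ := exists_collapse_cons (G := G) b (c :: l)
      rw [hl']
      exact ⟨b, l', rfl, Or.inl rfl⟩

theorem vertexList_eq {u v : V} {x : List E} (h : G.Walk u x v) (hx : x ≠ []) :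
    G.vertexList x = u :: x.map G.O := by
  induction x generalizing u with
  | nil => simp at hx
  | cons e x ih =>
    obtain ⟨rfl, h2⟩ := h
    cases x with
    | nil => simp [vertexList]
    | cons f x =>
      have := ih h2 (by simp)
      simp only [vertexList] at this
      simp [vertexList] at this ⊢
      exact this

/-- Lists in which no two consecutive steps are inner steps. -/
def Reduced (G : WeightedDigraph V E) : List V → Prop
  | a :: b :: c :: l => ¬ (G.Conn a b ∧ G.Conn b c) ∧ Reduced G (b :: c :: l)
  | _ => True

theorem reduced_cons_cons_cons {a b c : V} {l : List V} : G.Reduced (a :: b :: c :: l) ↔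
    ¬ (G.Conn a b ∧ G.Conn b c) ∧ G.Reduced (b :: c :: l) := by rw [Reduced]

theorem Reduced.tail {a : V} {l : List V} (h : G.Reduced (a :: l)) : G.Reduced l := by
  match l with
  | [] => simp [Reduced]
  | [b] => simp [Reduced]
  | b :: c :: l => exact (reduced_cons_cons_cons.1 h).2

/-- The two statements for the walk `x` are proved together: the itinerary of `x`, and the
itinerary of a path `y` inside a component followed by `x`. -/
theorem mem_along_collapse_aux {a v : V} {x : List E} (h : G.Walk a x v) :
    x ∈ G.along (G.collapse (a :: x.map G.O)) ∧
    ∀ u y, y ∈ G.paths u a → G.Conn u a → y ++ x ∈ G.along (G.collapse (u :: a :: x.map G.O)) := by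
  induction x generalizing a with
  | nil =>
    simp only [List.map_nil, collapse_singleton, along_singleton, collapse_pair]
    refine ⟨rfl, fun u y hy hu => ?_⟩
    rw [along_of_conn hu, along_singleton]
    exact ⟨y, hy, [], rfl, rfl⟩
  | cons f x ih =>
    obtain ⟨rfl, h2⟩ := h
    obtain ⟨ih1, ih2⟩ := ih h2
    have h1 : f :: x ∈ G.along (G.collapse (G.I f :: (f :: x).map G.O)) := by
      by_cases hc : G.Conn (G.I f) (G.O f)
      · simpa using ih2 _ _ (singleton_mem_paths f) hc
      · rw [List.map_cons]
        cases x with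
        | nil =>
          simp only [List.map_nil, collapse_pair, along_of_not_conn hc, along_singleton]
          exact ⟨f, rfl, rfl, [], rfl, rfl⟩
        | cons g x =>
          rw [List.map_cons, collapse_of_not (fun h => hc h.1)]
          obtain ⟨l', hl'⟩ := exists_collapse_cons (G := G) (G.O f) (G.O g :: x.map G.O)
          rw [List.map_cons] at ih1
          rw [hl'] at ih1 ⊢
          rw [along_of_not_conn hc]
          exact ⟨f, rfl, rfl, _, ih1, rfl⟩
    refine ⟨h1, fun u y hy hu => ?_⟩
    rw [List.map_cons]
    by_cases hc : G.Conn (G.I f) (G.O f)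
    · rw [collapse_of_conn hu hc]
      have := ih2 u (y ++ [f]) (paths_append hy (by simp)) (hu.trans hc)
      simpa using this
    · rw [collapse_of_not (fun h => hc h.2)]
      rw [List.map_cons] at h1
      obtain ⟨l', hl'⟩ := exists_collapse_cons (G := G) (G.I f) (G.O f :: x.map G.O)
      rw [hl'] at h1 ⊢
      rw [along_of_conn hu]
      exact ⟨y, hy, _, h1, rfl⟩

theorem mem_along_collapse {a v : V} {x : List E} (h : G.Walk a x v) :
    x ∈ G.along (G.collapse (a :: x.map G.O)) := (mem_along_collapse_aux h).1

theorem reduced_collapse (a : V) (l : List V) : G.Reduced (G.collapse (a :: l)) := by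
  suffices h : G.Reduced (G.collapse (a :: l)) ∧ ∀ u, G.Reduced (G.collapse (u :: a :: l)) from h.1
  induction l generalizing a with
  | nil => simp [Reduced]
  | cons b l ih =>
    obtain ⟨ih1, ih2⟩ := ih b
    refine ⟨ih2 a, fun u => ?_⟩
    by_cases h : G.Conn u a ∧ G.Conn a b
    · rw [collapse_of_conn h.1 h.2]
      exact ih2 u
    · rw [collapse_of_not h]
      have h3 := ih2 a
      obtain ⟨c, l', h4, h5⟩ := exists_collapse_cons_cons (G := G) a b l
      rw [h4] at h3 ⊢
      refine reduced_cons_cons_cons.2 ⟨fun h6 => h ⟨h6.1, ?_⟩, h3⟩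
      exact h5.elim (fun h => h ▸ h6.2) id

theorem collapse_append_of_conn {u b a : V} {y : List E} (hy : G.Walk b y a) (hub : G.Conn u b)
    (hba : G.Conn u a) (l : List V) :
    G.collapse (u :: b :: (y.map G.O ++ l)) = G.collapse (u :: a :: l) := by
  induction y generalizing b with
  | nil => rw [walk_nil] at hy; subst hy; rfl
  | cons f y ih =>
    obtain ⟨rfl, h2⟩ := hy
    have h3 : G.Conn (G.I f) (G.O f) :=
      Conn.of_walks (hub.symm.trans hba) (x := [f]) (by simp) h2
    rw [List.map_cons, List.cons_append, collapse_of_conn hub h3]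
    exact ih h2 (hub.trans h3)

/-- A walk along a reduced list of vertices has this list as its itinerary. -/
theorem collapse_of_mem_along {a : V} {l : List V} (hl : G.Reduced (a :: l)) {x : List E}
    (hx : x ∈ G.along (a :: l)) : G.collapse (a :: x.map G.O) = a :: l := by
  induction l generalizing a x with
  | nil =>
    rw [along_singleton] at hx
    rw [hx]
    simp
  | cons b l ih =>
    by_cases hab : G.Conn a b
    · rw [along_of_conn hab] at hx
      obtain ⟨y, hy, z, hz, rfl⟩ := hx
      have h1 := ih hl.tail hz
      obtain ⟨hy0, hy⟩ := mem_paths_iff.1 hy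
      cases y with
      | nil => simp at hy0
      | cons f y =>
        obtain ⟨rfl, hyw⟩ := hy
        have h3 : G.Conn (G.I f) (G.O f) := Conn.of_walks hab (x := [f]) (by simp) hyw
        rw [List.map_append, List.map_cons, List.cons_append, collapse_append_of_conn hyw h3 hab]
        cases l with
        | nil =>
          rw [along_singleton] at hz
          rw [hz]
          simp
        | cons c l =>
          have h2 := (reduced_cons_cons_cons.1 hl).1
          rw [along_of_not_conn (fun h => h2 ⟨hab, h⟩)] at hz
          obtain ⟨e, he, rfl, z, hz, rfl⟩ := hz
          rw [List.map_cons] at h1 ⊢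
          rw [collapse_of_not h2, h1]
    · rw [along_of_not_conn hab] at hx
      obtain ⟨e, rfl, rfl, z, hz, rfl⟩ := hx
      have h1 := ih hl.tail hz
      rw [List.map_cons]
      cases z with
      | nil => simpa using h1
      | cons g z =>
        rw [List.map_cons] at h1 ⊢
        rw [collapse_of_not (fun h => hab h.1), h1]

theorem walk_of_mem_along {a : V} {l : List V} {x : List E} (hx : x ∈ G.along (a :: l)) :
    G.Walk a x ((a :: l).getLast (by simp)) := by
  induction l generalizing a x with
  | nil =>
    rw [along_singleton] at hx
    rw [hx]
    simp
  | cons b l ih =>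
    by_cases hab : G.Conn a b
    · rw [along_of_conn hab] at hx
      obtain ⟨y, hy, z, hz, rfl⟩ := hx
      exact (mem_paths_iff.1 hy).2.append (by simpa using ih hz)
    · rw [along_of_not_conn hab] at hx
      obtain ⟨e, rfl, rfl, z, hz, rfl⟩ := hx
      exact ⟨rfl, by simpa using ih hz⟩

theorem itin_eq {u v : V} {x : List E} (hx : x ∈ G.paths u v) :
    G.itin x = G.collapse (u :: x.map G.O) := by
  obtain ⟨h1, h2⟩ := mem_paths_iff.1 hx
  rw [itin, vertexList_eq h2 h1]

/-- The paths with the same itinerary as a given path are the walks along it. -/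
theorem along_itin {u v : V} {x : List E} (hx : x ∈ G.paths u v) :
    G.along (G.itin x) = {y | y ∈ G.paths u v ∧ G.itin y = G.itin x} := by
  obtain ⟨hx0, hxw⟩ := mem_paths_iff.1 hx
  have h1 := mem_along_collapse hxw
  have h2 := reduced_collapse (G := G) u (x.map G.O)
  have h3 : ∃ c l, G.collapse (u :: x.map G.O) = u :: c :: l := by
    cases x with
    | nil => simp at hx0
    | cons e x =>
      obtain ⟨c, l, h, -⟩ := exists_collapse_cons_cons (G := G) u (G.O e) (x.map G.O)
      exact ⟨c, l, h⟩
  rw [itin_eq hx]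
  obtain ⟨c, l, h3⟩ := h3
  rw [h3] at h1 h2 ⊢
  ext y
  constructor
  · intro hy
    have h4 := walk_of_mem_along hy
    have h5 := collapse_of_mem_along h2 hy
    rw [(walk_of_mem_along h1).end_unique hxw] at h4
    have hy0 : y ≠ [] := by rintro rfl; simp at h5
    have := h4.mem_paths hy0
    exact ⟨this, by rw [itin_eq this, h5]⟩
  · rintro ⟨hy, hyi⟩
    rw [itin_eq hy] at hyi
    rw [← hyi]
    exact mem_along_collapse (mem_paths_iff.1 hy).2

theorem mem_along_itin {u v : V} {x : List E} (hx : x ∈ G.paths u v) :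
    x ∈ G.along (G.itin x) := by
  rw [along_itin hx]
  exact ⟨hx, rfl⟩

theorem exists_itin_eq_cons {u v : V} {x : List E} (hx : x ∈ G.paths u v) :
    ∃ l, G.itin x = u :: l ∧ G.Reduced (u :: l) := by
  rw [itin_eq hx]
  obtain ⟨l, hl⟩ := exists_collapse_cons (G := G) u (x.map G.O)
  exact ⟨l, hl, hl ▸ reduced_collapse u _⟩

/-! ### The length of an itinerary is bounded -/

theorem along_tail_nonempty {a b : V} {l : List V} (h : (G.along (a :: b :: l)).Nonempty) :
    (G.paths a b).Nonempty ∧ (G.along (b :: l)).Nonempty := by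
  obtain ⟨x, hx⟩ := h
  by_cases hab : G.Conn a b
  · rw [along_of_conn hab] at hx
    obtain ⟨y, hy, z, hz, -⟩ := hx
    exact ⟨⟨y, hy⟩, z, hz⟩
  · rw [along_of_not_conn hab] at hx
    obtain ⟨e, rfl, rfl, z, hz, -⟩ := hx
    exact ⟨⟨_, singleton_mem_paths e⟩, z, hz⟩

theorem exists_walk_of_along_nonempty {a c : V} {l : List V} (h : (G.along (a :: l)).Nonempty)
    (hc : c ∈ a :: l) : ∃ y, G.Walk a y c := by
  induction l generalizing a with
  | nil =>
    obtain rfl := List.mem_singleton.1 hc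
    exact ⟨[], rfl⟩
  | cons b l ih =>
    obtain ⟨⟨y, hy⟩, h2⟩ := along_tail_nonempty h
    rcases List.mem_cons.1 hc with rfl | hc
    · exact ⟨[], rfl⟩
    · obtain ⟨z, hz⟩ := ih h2 hc
      exact ⟨_, (mem_paths_iff.1 hy).2.append hz⟩

theorem not_conn_of_reduced {a b c : V} {l : List V} (hl : G.Reduced (a :: b :: l))
    (h : (G.along (a :: b :: l)).Nonempty) (hc : c ∈ l) : ¬ G.Conn a c := by
  cases l with
  | nil => simp at hc
  | cons d l =>
    intro hac
    obtain ⟨hab, h⟩ := along_tail_nonempty h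
    obtain ⟨hbd, h⟩ := along_tail_nonempty h
    obtain ⟨y, hdc⟩ := exists_walk_of_along_nonempty h hc
    have hda := hdc.paths_nonempty hac.2
    exact (reduced_cons_cons_cons.1 hl).1
      ⟨⟨hab, paths_nonempty_trans hbd hda⟩, ⟨hbd, paths_nonempty_trans hda hab⟩⟩

theorem count_le_two [DecidableEq V] {a : V} {l : List V} (hl : G.Reduced (a :: l))
    (h : (G.along (a :: l)).Nonempty) (c : V) : (a :: l).count c ≤ 2 := by
  induction l generalizing a with
  | nil => exact List.count_le_length.trans (by simp)
  | cons b l ih =>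
    obtain ⟨hab, h2⟩ := along_tail_nonempty h
    by_cases hac : a = c
    · subst hac
      have hal : a ∉ l := fun hal => by
        obtain ⟨y, hy⟩ := exists_walk_of_along_nonempty h2 (List.mem_cons_of_mem b hal)
        have := hy.paths_nonempty' hab
        exact not_conn_of_reduced hl h hal ⟨this, this⟩
      rw [List.count_cons_self, List.count_cons, List.count_eq_zero_of_not_mem hal]
      split <;> simp
    · rw [List.count_cons_of_ne hac]
      exact ih hl.tail h2

theorem finite_itin [Finite V] (u v : V) : (G.itin '' G.paths u v).Finite := by
  classical
  have := Fintype.ofFinite V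
  refine (List.finite_length_le V (Fintype.card V * 2)).subset ?_
  rintro _ ⟨x, hx, rfl⟩
  have h1 := mem_along_itin hx
  obtain ⟨l, hl, hr⟩ := exists_itin_eq_cons hx
  rw [hl] at h1 ⊢
  change (u :: l).length ≤ _
  rw [← List.sum_toFinset_count_eq_length]
  refine (Finset.sum_le_card_nsmul _ _ 2 fun c _ => count_le_two hr ⟨x, h1⟩ c).trans ?_
  rw [smul_eq_mul]
  exact Nat.mul_le_mul_right 2 (Finset.card_le_univ _)

/-! ### The inner steps of an itinerary -/

theorem steps_cons_cons (a b : V) (l : List V) : steps (a :: b :: l) = (a, b) :: steps (b :: l) :=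
  rfl

theorem innerSteps_singleton (a : V) : G.innerSteps [a] = [] := rfl

theorem outerSteps_singleton (a : V) : G.outerSteps [a] = [] := rfl

theorem innerSteps_of_conn {a b : V} (h : G.Conn a b) (l : List V) :
    G.innerSteps (a :: b :: l) = (a, b) :: G.innerSteps (b :: l) := by
  simp [innerSteps, steps_cons_cons, h]

theorem innerSteps_of_not_conn {a b : V} (h : ¬ G.Conn a b) (l : List V) :
    G.innerSteps (a :: b :: l) = G.innerSteps (b :: l) := by
  simp [innerSteps, steps_cons_cons, h]

theorem outerSteps_of_conn {a b : V} (h : G.Conn a b) (l : List V) :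
    G.outerSteps (a :: b :: l) = G.outerSteps (b :: l) := by
  simp [outerSteps, steps_cons_cons, h]

theorem outerSteps_of_not_conn {a b : V} (h : ¬ G.Conn a b) (l : List V) :
    G.outerSteps (a :: b :: l) = (a, b) :: G.outerSteps (b :: l) := by
  simp [outerSteps, steps_cons_cons, h]

theorem mem_innerSteps {σ : List V} {q : V × V} (h : q ∈ G.innerSteps σ) :
    q.1 ∈ σ ∧ G.Conn q.1 q.2 := by
  simp only [innerSteps, List.mem_filter, decide_eq_true_eq] at h
  exact ⟨(List.of_mem_zip h.1).1, h.2⟩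

theorem nodup_innerSteps {a : V} {l : List V} (hl : G.Reduced (a :: l))
    (h : (G.along (a :: l)).Nonempty) :
    ((G.innerSteps (a :: l)).map fun q => G.cls q.1).Nodup := by
  induction l generalizing a with
  | nil => simp [innerSteps_singleton]
  | cons b l ih =>
    have h2 := (along_tail_nonempty h).2
    by_cases hab : G.Conn a b
    · rw [innerSteps_of_conn hab, List.map_cons, List.nodup_cons]
      refine ⟨fun hm => ?_, ih hl.tail h2⟩
      obtain ⟨q, hq, hqa⟩ := List.mem_map.1 hm
      have h3 : G.Conn a q.1 := by
        rw [← mem_cls, ← hqa]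
        exact (mem_innerSteps hq).2.left
      cases l with
      | nil => simp [innerSteps_singleton] at hq
      | cons d l =>
        rw [innerSteps_of_not_conn (fun hbd => (reduced_cons_cons_cons.1 hl).1 ⟨hab, hbd⟩)] at hq
        exact not_conn_of_reduced hl h (mem_innerSteps hq).1 h3
    · rw [innerSteps_of_not_conn hab]
      exact ih hl.tail h2

theorem exists_edge_of_mem_innerSteps {a : V} {l : List V} {x : List E}
    (hx : x ∈ G.along (a :: l)) {q : V × V} (hq : q ∈ G.innerSteps (a :: l)) :
    ∃ e ∈ x, G.I e = q.1 := by
  induction l generalizing a x with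
  | nil => simp [innerSteps_singleton] at hq
  | cons b l ih =>
    by_cases hab : G.Conn a b
    · rw [along_of_conn hab] at hx
      obtain ⟨y, hy, z, hz, rfl⟩ := hx
      rw [innerSteps_of_conn hab, List.mem_cons] at hq
      rcases hq with rfl | hq
      · obtain ⟨hy0, hy⟩ := mem_paths_iff.1 hy
        cases y with
        | nil => simp at hy0
        | cons e y => exact ⟨e, by simp, hy.1⟩
      · obtain ⟨e, he, h⟩ := ih hz hq
        exact ⟨e, List.mem_append_right _ he, h⟩
    · rw [along_of_not_conn hab] at hx
      obtain ⟨e, rfl, rfl, z, hz, rfl⟩ := hx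
      rw [innerSteps_of_not_conn hab] at hq
      obtain ⟨e', he, h⟩ := ih hz hq
      exact ⟨e', List.mem_cons_of_mem _ he, h⟩

theorem exists_mem_innerSteps_of_edge {a : V} {l : List V} {x : List E}
    (hx : x ∈ G.along (a :: l)) {e : E} (he : e ∈ x) (hc : G.Conn (G.I e) (G.O e)) :
    ∃ q ∈ G.innerSteps (a :: l), G.Conn q.1 (G.I e) := by
  induction l generalizing a x with
  | nil =>
    rw [along_singleton] at hx
    rw [hx] at he
    simp at he
  | cons b l ih =>
    by_cases hab : G.Conn a b
    · rw [along_of_conn hab] at hx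
      obtain ⟨y, hy, z, hz, rfl⟩ := hx
      rw [innerSteps_of_conn hab]
      rcases List.mem_append.1 he with he | he
      · refine ⟨(a, b), by simp, ?_⟩
        obtain ⟨p, r, rfl, h1, h2⟩ := exists_split (mem_paths_iff.1 hy).2 he
        exact Conn.of_walks hab h1 (y := e :: r) (by simpa using h2)
      · obtain ⟨q, hq, h⟩ := ih hz he
        exact ⟨q, List.mem_cons_of_mem _ hq, h⟩
    · rw [along_of_not_conn hab] at hx
      obtain ⟨e', rfl, rfl, z, hz, rfl⟩ := hx
      rw [innerSteps_of_not_conn hab]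
      rcases List.mem_cons.1 he with rfl | he
      · exact absurd hc hab
      · exact ih hz he

theorem length_innerSteps_eq_ncard {u v : V} {x : List E} (hx : x ∈ G.paths u v) :
    (G.innerSteps (G.itin x)).length
      = {C | ∃ q ∈ G.innerSteps (G.itin x), G.cls q.1 = C}.ncard := by
  classical
  obtain ⟨l, hl, hr⟩ := exists_itin_eq_cons hx
  have h1 := mem_along_itin hx
  rw [hl] at h1 ⊢
  have h2 := nodup_innerSteps hr ⟨x, h1⟩
  rw [← List.length_map (fun q => G.cls q.1), ← List.toFinset_card_of_nodup h2,
    ← Set.ncard_coe_finset]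
  congr 1
  ext C
  simp

theorem length_innerSteps_le_numSCC [Finite V] {u v : V} {x : List E} (hx : x ∈ G.paths u v) :
    (G.innerSteps (G.itin x)).length ≤ G.numSCC x := by
  rw [length_innerSteps_eq_ncard hx]
  refine Set.ncard_le_ncard ?_ (Set.toFinite _)
  rintro _ ⟨q, hq, rfl⟩
  have h2 := (mem_innerSteps hq).2
  obtain ⟨l, hl, hr⟩ := exists_itin_eq_cons hx
  have h1 := mem_along_itin hx
  rw [hl] at h1 hq
  obtain ⟨e, he, hq1⟩ := exists_edge_of_mem_innerSteps h1 hq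
  exact ⟨h2.isSCC, q.1, h2.left, e, he, Or.inl hq1.symm⟩

/-- Inserting closed paths into a walk wherever this is possible. -/
theorem exists_walk_with_turns {u v : V} {x : List E} (hx : G.Walk u x v) :
    ∃ y, G.Walk u y v ∧ (x ≠ [] → y ≠ []) ∧ ∀ a, (a = u ∨ ∃ e ∈ x, a = G.O e) → G.Conn a a →
      ∃ e ∈ y, G.I e = a ∧ G.Conn (G.I e) (G.O e) := by
  have turn : ∀ u, ∃ y, G.Walk u y u ∧ (G.Conn u u →
      ∃ e ∈ y, G.I e = u ∧ G.Conn (G.I e) (G.O e)) := by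
    intro u
    by_cases hu : G.Conn u u
    · obtain ⟨y, hy⟩ := hu.1
      obtain ⟨hy0, hy⟩ := mem_paths_iff.1 hy
      refine ⟨y, hy, fun _ => ?_⟩
      cases y with
      | nil => simp at hy0
      | cons e y =>
        obtain ⟨rfl, h2⟩ := hy
        exact ⟨e, by simp, rfl, Conn.of_walks hu (x := [e]) (by simp) h2⟩
    · exact ⟨[], rfl, fun h => absurd h hu⟩
  induction x generalizing u with
  | nil =>
    rw [walk_nil] at hx
    subst hx
    obtain ⟨y, h1, h2⟩ := turn u
    exact ⟨y, h1, by simp, fun a ha => by simp at ha; subst ha; exact h2⟩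
  | cons f x ih =>
    obtain ⟨rfl, hx⟩ := hx
    obtain ⟨y, h1, -, h2⟩ := ih hx
    obtain ⟨z, h3, h4⟩ := turn (G.I f)
    refine ⟨z ++ f :: y, h3.append ⟨rfl, h1⟩, by simp, ?_⟩
    rintro a (rfl | ⟨e, he, rfl⟩) ha
    · obtain ⟨e, he, h5⟩ := h4 ha
      exact ⟨e, by simp [he], h5⟩
    · obtain ⟨e', he', h5⟩ := h2 (G.O e) (by
        rcases List.mem_cons.1 he with rfl | he
        · exact Or.inl rfl
        · exact Or.inr ⟨e, he, rfl⟩) ha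
      exact ⟨e', by simp [he'], h5⟩

theorem exists_numSCC_le_length_innerSteps [Finite V] {u v : V} {x : List E}
    (hx : x ∈ G.paths u v) :
    ∃ y ∈ G.paths u v, G.numSCC x ≤ (G.innerSteps (G.itin y)).length := by
  obtain ⟨hx0, hxw⟩ := mem_paths_iff.1 hx
  obtain ⟨y, hy, hy0, h⟩ := exists_walk_with_turns hxw
  have hyp := hy.mem_paths (hy0 hx0)
  refine ⟨y, hyp, ?_⟩
  rw [length_innerSteps_eq_ncard hyp]
  refine Set.ncard_le_ncard ?_ (Set.toFinite _)
  rintro C ⟨hC, a, haC, e, he, hae⟩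
  have haa := hC.conn haC haC
  obtain ⟨f, hf, rfl, h4⟩ := h a (by
    rcases hae with rfl | rfl
    · obtain ⟨p, q, rfl, hp, hq⟩ := exists_split hxw he
      rcases p.eq_nil_or_concat with rfl | ⟨p, g, rfl⟩
      · exact Or.inl hp.symm
      · rw [List.concat_eq_append, walk_append] at hp
        obtain ⟨b, -, -, h3⟩ := hp
        exact Or.inr ⟨g, by simp, h3.symm⟩
    · exact Or.inr ⟨e, he, rfl⟩) haa
  obtain ⟨l, hl, hr⟩ := exists_itin_eq_cons hyp
  have h1 := mem_along_itin hyp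
  rw [hl] at h1
  obtain ⟨q, hq, hqc⟩ := exists_mem_innerSteps_of_edge h1 hf h4
  exact ⟨q, hl ▸ hq, by rw [hC.eq_cls haC]; exact hqc.cls_eq⟩

end WeightedDigraph
end

noncomputable section

namespace WeightedDigraph

variable {V E : Type*} {G : WeightedDigraph V E}

/-! ### Components that are cycles -/

theorem inner_of_walk {u v : V} (h : G.Conn u v) {x : List E} (hx : G.Walk u x v) {e : E}
    (he : e ∈ x) : G.Conn u (G.I e) ∧ G.Conn (G.I e) (G.O e) := by
  obtain ⟨y, z, rfl, h1, h2⟩ := exists_split hx he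
  have h3 : G.Conn u (G.I e) := Conn.of_walks h h1 (y := e :: z) (by simpa using h2)
  exact ⟨h3, Conn.of_walks (h3.symm.trans h) (x := [e]) (by simp) h2⟩

/-- In the component of `a`, every vertex is the starting point of at most one edge. -/
def Deterministic (G : WeightedDigraph V E) (a : V) : Prop :=
  ∀ f g, G.Conn a (G.I f) → G.I f = G.I g → G.Conn (G.I f) (G.O f) → G.Conn (G.I g) (G.O g) →
    f = g

theorem IsCycle.deterministic {a : V} (h : (G.induce (G.cls a)).IsCycle) :
    G.Deterministic a := by
  intro f g haf hfg hf hg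
  obtain ⟨e, he⟩ := Set.ncard_eq_one.1 (h.2 ⟨G.I f, haf⟩).2
  have h1 : (⟨f, haf, haf.trans hf⟩ : {e : E // G.I e ∈ G.cls a ∧ G.O e ∈ G.cls a}) = e := by
    rw [← Set.mem_singleton_iff, ← he]
    rfl
  have h2 : (⟨g, hfg ▸ haf, (hfg ▸ haf : G.Conn a (G.I g)).trans hg⟩ :
      {e : E // G.I e ∈ G.cls a ∧ G.O e ∈ G.cls a}) = e := by
    rw [← Set.mem_singleton_iff, ← he]
    exact Subtype.ext hfg.symm
  exact congrArg Subtype.val (h1.trans h2.symm)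

theorem Deterministic.conn {a b : V} (h : G.Deterministic a) (hab : G.Conn a b) :
    G.Deterministic b := fun f g hf => h f g (hab.trans hf)

theorem Deterministic.exists_suffix {a u v w : V} (hdet : G.Deterministic a) {x y : List E}
    (hx : G.Walk u x v) (hy : G.Walk u y w)
    (hxc : ∀ e ∈ x, G.Conn a (G.I e) ∧ G.Conn (G.I e) (G.O e))
    (hyc : ∀ e ∈ y, G.Conn a (G.I e) ∧ G.Conn (G.I e) (G.O e)) (hlen : x.length ≤ y.length) :
    ∃ r, y = x ++ r ∧ G.Walk v r w := by
  induction x generalizing u y with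
  | nil => rw [walk_nil] at hx; subst hx; exact ⟨y, rfl, hy⟩
  | cons e x ih =>
    cases y with
    | nil => simp at hlen
    | cons f y =>
      obtain ⟨rfl, hx⟩ := hx
      obtain ⟨hef, hy⟩ := hy
      obtain ⟨h1, h2⟩ := hxc e (by simp)
      obtain rfl := hdet e f h1 hef.symm h2 (hyc f (by simp)).2
      obtain ⟨r, rfl, hr⟩ := ih hx hy (fun e he => hxc e (List.mem_cons_of_mem _ he))
        (fun e he => hyc e (List.mem_cons_of_mem _ he)) (by simpa using hlen)
      exact ⟨r, rfl, hr⟩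

theorem exists_shortest {u v : V} (h : (G.paths u v).Nonempty) :
    ∃ x ∈ G.paths u v, ∀ y ∈ G.paths u v, x.length ≤ y.length :=
  ⟨Function.argminOn List.length _ h, Function.argminOn_mem _ _ h,
    fun _ hy => Function.argminOn_le List.length (G.paths u v) hy⟩

theorem exists_split_of_not_nodup {A : Type*} {l : List A} (h : ¬ l.Nodup) :
    ∃ a x y z, l = x ++ a :: (y ++ a :: z) := by
  induction l with
  | nil => simp at h
  | cons b l ih =>
    by_cases hb : b ∈ l
    · obtain ⟨y, z, rfl⟩ := List.append_of_mem hb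
      exact ⟨b, [], y, z, rfl⟩
    · obtain ⟨a, x, y, z, rfl⟩ := ih (fun hl => h (List.nodup_cons.2 ⟨hb, hl⟩))
      exact ⟨a, b :: x, y, z, rfl⟩

theorem weight_shortest_eq_cycleWeight [Fintype E] {b : V} (hdet : G.Deterministic b)
    {l : List E} (hl : l ∈ G.paths b b) (hmin : ∀ y ∈ G.paths b b, l.length ≤ y.length) :
    G.weight l = G.cycleWeight (G.cls b) := by
  classical
  obtain ⟨hl0, hlw⟩ := mem_paths_iff.1 hl
  have hb : G.Conn b b := ⟨⟨l, hl⟩, ⟨l, hl⟩⟩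
  have hnodup : l.Nodup := by
    by_contra h
    obtain ⟨e, x, y, z, rfl⟩ := exists_split_of_not_nodup h
    obtain ⟨a, h1, h2⟩ := walk_append.1 hlw
    obtain rfl := h2.1
    obtain ⟨a', -, h3⟩ := walk_append.1 h2.2
    obtain ⟨rfl, h3⟩ := (walk_cons G).1 h3
    have := hmin (x ++ e :: z) ((h1.append (by simpa using h3)).mem_paths (by simp))
    simp at this
    omega
  have hnext : ∀ e ∈ l, ∃ f ∈ l, G.I f = G.O e := by
    intro e he
    obtain ⟨y, z, hyz, h1, h2⟩ := exists_split hlw he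
    cases z with
    | nil =>
      rw [walk_nil] at h2
      cases l with
      | nil => simp at hl0
      | cons f l => exact ⟨f, by simp, by rw [h2]; exact hlw.1⟩
    | cons f z => exact ⟨f, by rw [hyz]; simp, h2.1⟩
  have hall : ∀ y u w, G.Walk u y w → (∃ f ∈ l, G.I f = u) →
      (∀ e ∈ y, G.Conn b (G.I e) ∧ G.Conn (G.I e) (G.O e)) → ∀ e ∈ y, e ∈ l := by
    intro y
    induction y with
    | nil => simp
    | cons e y ih =>
      rintro u w ⟨rfl, h2⟩ ⟨f, hf, hfe⟩ hy
      obtain ⟨h3, h4⟩ := hy e (by simp)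
      obtain rfl := hdet e f h3 hfe.symm h4 (inner_of_walk hb hlw hf).2
      intro e' he'
      rcases List.mem_cons.1 he' with rfl | he'
      · exact hf
      · exact ih _ _ h2 (hnext e hf) (fun e he => hy e (List.mem_cons_of_mem _ he)) e' he'
  have hset : (Finset.univ.filter fun e => G.I e ∈ G.cls b ∧ G.O e ∈ G.cls b) = l.toFinset := by
    ext e
    simp only [Finset.mem_filter, Finset.mem_univ, true_and, List.mem_toFinset, mem_cls]
    constructor
    · rintro ⟨h1, h2⟩
      obtain ⟨y, hy⟩ := h1.1
      have hw : G.Walk b (y ++ [e]) (G.O e) := (mem_paths_iff.1 hy).2.append (by simp)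
      refine hall _ _ _ hw ?_ (fun f hf => inner_of_walk h2 hw hf) e (by simp)
      cases l with
      | nil => simp at hl0
      | cons f l => exact ⟨f, by simp, hlw.1⟩
    · intro he
      obtain ⟨h1, h2⟩ := inner_of_walk hb hlw he
      exact ⟨h1, h1.trans h2⟩
  rw [cycleWeight, weight, ← List.sum_toFinset _ hnodup, ← hset]

/-! ### Growth of the number of walks along an itinerary -/

theorem growth_along_of_conn [Fintype E] {a b : V} {l : List V} (hab : G.Conn a b)
    (hl : G.Reduced (a :: b :: l)) (hcyc : G.Deterministic a) {k : ℕ} {L : ℝ}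
    (h : G.Growth (G.along (b :: l)) k L) :
    G.Growth (G.along (a :: b :: l)) (k + 1) (L / ((k + 1) * G.cycleWeight (G.cls a))) := by
  have hdet := hcyc.conn hab
  have hbb := hab.right
  obtain ⟨y₀, hy₀, hy₀min⟩ := exists_shortest hab.1
  obtain ⟨t, ht, htmin⟩ := exists_shortest hbb.1
  obtain ⟨ht0, htw⟩ := mem_paths_iff.1 ht
  set T : Set (List E) := {x | ∃ r, G.Walk b r b ∧ ∃ z ∈ G.along (b :: l), x = r ++ z} with hT
  have h1 : G.along (a :: b :: l) = (y₀ ++ ·) '' T := by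
    rw [along_of_conn hab]
    ext x
    constructor
    · rintro ⟨y, hy, z, hz, rfl⟩
      have hyw := (mem_paths_iff.1 hy).2
      have hy₀w := (mem_paths_iff.1 hy₀).2
      obtain ⟨r, rfl, hr⟩ := hcyc.exists_suffix hy₀w hyw (fun _ => inner_of_walk hab hy₀w)
        (fun _ => inner_of_walk hab hyw) (hy₀min y hy)
      exact ⟨r ++ z, ⟨r, hr, z, hz, rfl⟩, by simp⟩
    · rintro ⟨_, ⟨r, hr, z, hz, rfl⟩, rfl⟩
      exact ⟨y₀ ++ r, paths_append hy₀ hr, z, hz, by simp⟩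
  have h2 : T = G.along (b :: l) ∪ (t ++ ·) '' T := by
    ext x
    constructor
    · rintro ⟨r, hr, z, hz, rfl⟩
      by_cases hr0 : r = []
      · subst hr0
        exact Or.inl hz
      · obtain ⟨r', rfl, hr'⟩ := hdet.exists_suffix htw hr (fun _ => inner_of_walk hbb htw)
          (fun _ => inner_of_walk hbb hr) (htmin r (hr.mem_paths hr0))
        exact Or.inr ⟨r' ++ z, ⟨r', hr', z, hz, rfl⟩, by simp⟩
    · rintro (hx | ⟨_, ⟨r, hr, z, hz, rfl⟩, rfl⟩)
      · exact ⟨[], rfl, x, hx, rfl⟩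
      · exact ⟨t ++ r, htw.append hr, z, hz, by simp⟩
  have h3 : Disjoint (G.along (b :: l)) ((t ++ ·) '' T) := by
    rw [Set.disjoint_left]
    rintro _ hx ⟨y, -, rfl⟩
    cases t with
    | nil => exact ht0 rfl
    | cons e t =>
      have he := (inner_of_walk hbb htw (e := e) (by simp)).2
      cases l with
      | nil => simp [along_singleton] at hx
      | cons c l =>
        rw [along_of_not_conn (fun hbc => (reduced_cons_cons_cons.1 hl).1 ⟨hab, hbc⟩)] at hx
        obtain ⟨f, rfl, rfl, z, hz, hfz⟩ := hx
        simp only [List.cons_append, List.cons.injEq] at hfz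
        obtain ⟨rfl, -⟩ := hfz
        exact (reduced_cons_cons_cons.1 hl).1 ⟨hab, he⟩
  rw [h1, hab.cls_eq, ← weight_shortest_eq_cycleWeight hdet ht htmin]
  exact (h.of_eq_union ht0 h2 h3).image_append y₀

theorem growth_along_of_not_conn [Fintype E] {a b : V} {l : List V} (hab : ¬ G.Conn a b)
    {k : ℕ} {L : ℝ} (h : G.Growth (G.along (b :: l)) k L) :
    G.Growth (G.along (a :: b :: l)) k ({e | G.I e = a ∧ G.O e = b}.ncard * L) := by
  classical
  have h1 : G.along (a :: b :: l) = ⋃ e ∈ Finset.univ.filter (fun e => G.I e = a ∧ G.O e = b),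
      ([e] ++ ·) '' G.along (b :: l) := by
    rw [along_of_not_conn hab]
    ext x
    simp only [Set.mem_ofPred_eq, Set.mem_iUnion, Finset.mem_filter, Finset.mem_univ, true_and,
      Set.mem_image]
    constructor
    · rintro ⟨e, h1, h2, z, hz, rfl⟩
      exact ⟨e, ⟨h1, h2⟩, z, hz, rfl⟩
    · rintro ⟨e, ⟨h1, h2⟩, z, hz, rfl⟩
      exact ⟨e, h1, h2, z, hz, rfl⟩
  have h2 : ({e | G.I e = a ∧ G.O e = b}.ncard : ℝ) * L
      = ∑ e ∈ Finset.univ.filter (fun e => G.I e = a ∧ G.O e = b), L := by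
    rw [Finset.sum_const, nsmul_eq_mul, ← Set.ncard_coe_finset]
    simp
  rw [h1, h2]
  refine Growth.biUnion (fun e _ f _ hef => ?_) fun e _ => h.image_append [e]
  rw [Set.disjoint_left]
  rintro _ ⟨y, -, rfl⟩ ⟨z, -, hyz⟩
  simp only [List.cons_append, List.cons.injEq] at hyz
  exact hef hyz.1.symm

theorem growth_along [Fintype E] {a : V} {l : List V} (hl : G.Reduced (a :: l))
    (hcyc : ∀ q ∈ G.innerSteps (a :: l), G.Deterministic q.1) :
    G.Growth (G.along (a :: l)) (G.innerSteps (a :: l)).length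
      (G.itinMult (a :: l) / G.itinValue (a :: l)) := by
  induction l generalizing a with
  | nil =>
    rw [along_singleton]
    simpa [innerSteps_singleton, itinMult, outerSteps_singleton, itinValue] using
      growth_singleton_nil (G := G)
  | cons b l ih =>
    by_cases hab : G.Conn a b
    · rw [innerSteps_of_conn hab] at hcyc ⊢
      have h1 := growth_along_of_conn hab hl (hcyc (a, b) (by simp))
        (ih hl.tail fun q hq => hcyc q (List.mem_cons_of_mem _ hq))
      have h2 : G.itinMult (a :: b :: l) / G.itinValue (a :: b :: l)
          = G.itinMult (b :: l) / G.itinValue (b :: l)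
            / (((G.innerSteps (b :: l)).length + 1) * G.cycleWeight (G.cls a)) := by
        unfold itinMult itinValue
        rw [outerSteps_of_conn hab, innerSteps_of_conn hab, div_div]
        simp only [List.length_cons, Nat.factorial_succ, List.map_cons, List.prod_cons]
        push_cast
        ring_nf
      rw [h2]
      exact h1
    · rw [innerSteps_of_not_conn hab] at hcyc ⊢
      have h1 := growth_along_of_not_conn hab (ih hl.tail hcyc)
      have h2 : G.itinMult (a :: b :: l) / G.itinValue (a :: b :: l)
          = {e | G.I e = a ∧ G.O e = b}.ncard
            * (G.itinMult (b :: l) / G.itinValue (b :: l)) := by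
        unfold itinMult itinValue
        rw [outerSteps_of_not_conn hab, innerSteps_of_not_conn hab, List.map_cons, List.prod_cons,
          mul_div_assoc]
      rw [h2]
      exact h1

theorem itinMult_pos [Finite E] {a : V} {l : List V} (h : (G.along (a :: l)).Nonempty) :
    0 < G.itinMult (a :: l) := by
  induction l generalizing a with
  | nil => simp [itinMult, outerSteps_singleton]
  | cons b l ih =>
    have h1 := ih (along_tail_nonempty h).2
    by_cases hab : G.Conn a b
    · rwa [itinMult, outerSteps_of_conn hab]
    · rw [itinMult, outerSteps_of_not_conn hab, List.map_cons, List.prod_cons]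
      refine mul_pos ?_ h1
      obtain ⟨x, hx⟩ := h
      rw [along_of_not_conn hab] at hx
      obtain ⟨e, he⟩ := hx
      rw [Nat.cast_pos, Set.ncard_pos (Set.toFinite _)]
      exact ⟨e, he.1, he.2.1⟩

theorem cycleWeight_pos [Fintype E] {a b : V} (hab : G.Conn a b) :
    0 < G.cycleWeight (G.cls a) := by
  obtain ⟨x, hx⟩ := hab.1
  obtain ⟨hx0, hx⟩ := mem_paths_iff.1 hx
  refine Finset.sum_pos (fun e _ => G.W_pos e) ?_
  cases x with
  | nil => simp at hx0
  | cons e x =>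
    obtain ⟨h1, h2⟩ := inner_of_walk hab hx (e := e) (by simp)
    exact ⟨e, by simpa using ⟨h1, h1.trans h2⟩⟩

theorem itinValue_pos [Fintype E] (σ : List V) : 0 < G.itinValue σ := by
  refine mul_pos (by positivity) (List.prod_pos fun w hw => ?_)
  obtain ⟨q, hq, rfl⟩ := List.mem_map.1 hw
  exact cycleWeight_pos (mem_innerSteps hq).2

/-! ### Paths meeting no component, and components that are all cycles -/

theorem paths_eq_biUnion [Finite V] (u v : V) : G.paths u v
    = ⋃ σ ∈ (finite_itin (G := G) u v).toFinset, G.along σ := by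
  ext x
  simp only [Set.mem_iUnion, Set.Finite.mem_toFinset, exists_prop]
  constructor
  · exact fun hx => ⟨_, ⟨x, hx, rfl⟩, mem_along_itin hx⟩
  · rintro ⟨_, ⟨y, hy, rfl⟩, hx⟩
    rw [along_itin hy] at hx
    exact hx.1

theorem isSCCOn_of_mem_innerSteps {u v : V} {x : List E} (hx : x ∈ G.paths u v) {q : V × V}
    (hq : q ∈ G.innerSteps (G.itin x)) : G.IsSCCOn (G.paths u v) (G.cls q.1) := by
  have h2 := (mem_innerSteps hq).2
  obtain ⟨l, hl, hr⟩ := exists_itin_eq_cons hx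
  have h1 := mem_along_itin hx
  rw [hl] at h1 hq
  obtain ⟨e, he, hq1⟩ := exists_edge_of_mem_innerSteps h1 hq
  exact h2.isSCCOn ⟨x, hx, e, he, Or.inl hq1.symm⟩

theorem along_finite [Finite E] {a : V} {l : List V} (h : G.innerSteps (a :: l) = []) :
    (G.along (a :: l)).Finite := by
  induction l generalizing a with
  | nil => rw [along_singleton]; exact Set.finite_singleton _
  | cons b l ih =>
    by_cases hab : G.Conn a b
    · simp [innerSteps_of_conn hab] at h
    · rw [innerSteps_of_not_conn hab] at h
      rw [along_of_not_conn hab]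
      refine (Set.Finite.image2 (fun (e : E) z => e :: z) (Set.toFinite Set.univ) (ih h)).subset ?_
      rintro _ ⟨e, -, -, z, hz, rfl⟩
      exact ⟨e, trivial, z, hz, rfl⟩

theorem paths_finite [Finite V] [Finite E] {u v : V}
    (h : ¬ ∃ C, G.IsSCCOn (G.paths u v) C) : (G.paths u v).Finite := by
  rw [paths_eq_biUnion]
  refine Set.Finite.biUnion (Finset.finite_toSet _) fun σ hσ => ?_
  rw [Finset.mem_coe, Set.Finite.mem_toFinset] at hσ
  obtain ⟨x, hx, rfl⟩ := hσ
  have h1 : G.innerSteps (G.itin x) = [] := List.eq_nil_iff_forall_not_mem.2 fun q hq =>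
    h ⟨_, isSCCOn_of_mem_innerSteps hx hq⟩
  obtain ⟨l, hl, -⟩ := exists_itin_eq_cons hx
  rw [hl] at h1 ⊢
  exact along_finite h1

theorem exists_isGreatest_numSCC [Finite V] {X : Set (List E)} (hX : X.Nonempty) :
    ∃ c, IsGreatest {k | ∃ x ∈ X, G.numSCC x = k} c := by
  have hb : BddAbove {k | ∃ x ∈ X, G.numSCC x = k} := by
    refine ⟨Nat.card (Set V), ?_⟩
    rintro _ ⟨x, -, rfl⟩
    exact Set.ncard_le_card _
  obtain ⟨x, hx⟩ := hX
  exact ⟨_, Nat.sSup_mem ⟨_, x, hx, rfl⟩ hb, fun k hk => le_csSup hb hk⟩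

theorem one_le_of_isGreatest_numSCC [Finite V] {X : Set (List E)} {c : ℕ}
    (hc : IsGreatest {k | ∃ x ∈ X, G.numSCC x = k} c) (h : ∃ C, G.IsSCCOn X C) : 1 ≤ c := by
  obtain ⟨C, hC, hCX⟩ := h
  obtain ⟨a, ha⟩ := hC.1
  obtain ⟨x, hx, hax⟩ := hCX ha
  refine le_trans ?_ (hc.2 ⟨x, hx, rfl⟩)
  exact (Set.ncard_pos (Set.toFinite _)).2 ⟨C, hC, a, ha, hax⟩

theorem growth_paths [Fintype V] [Fintype E] {u v : V}
    (hcyc : ∀ C, G.IsSCCOn (G.paths u v) C → (G.induce C).IsCycle) {c : ℕ}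
    (hc : IsGreatest {k | ∃ x ∈ G.paths u v, G.numSCC x = k} c) :
    0 < (G.cycleLimit (G.paths u v) c)⁻¹ ∧
      G.Growth (G.paths u v) c (G.cycleLimit (G.paths u v) c)⁻¹ := by
  classical
  have hsum : (G.cycleLimit (G.paths u v) c)⁻¹ = ∑ σ ∈ (finite_itin (G := G) u v).toFinset,
      if (G.innerSteps σ).length = c then G.itinMult σ / G.itinValue σ else 0 := by
    rw [cycleLimit, inv_inv, ← Finset.sum_filter, ← finsum_mem_coe_finset]
    refine finsum_mem_congr (Set.ext fun σ => ?_) fun _ _ => rfl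
    simp
  rw [hsum]
  constructor
  · refine Finset.sum_pos' (fun σ hσ => ?_) ?_
    · rw [Set.Finite.mem_toFinset] at hσ
      obtain ⟨x, hx, rfl⟩ := hσ
      obtain ⟨l, hl, -⟩ := exists_itin_eq_cons hx
      have h1 := mem_along_itin hx
      rw [hl] at h1 ⊢
      have := itinMult_pos ⟨x, h1⟩
      have := itinValue_pos (G := G) (u :: l)
      split <;> positivity
    · obtain ⟨x, hx, hxc⟩ := hc.1
      obtain ⟨y, hy, hyc⟩ := exists_numSCC_le_length_innerSteps hx
      have h2 := hc.2 ⟨y, hy, rfl⟩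
      have h3 := length_innerSteps_le_numSCC hy
      refine ⟨G.itin y, by simpa using ⟨y, hy, rfl⟩, ?_⟩
      rw [if_pos (by omega)]
      obtain ⟨l, hl, -⟩ := exists_itin_eq_cons hy
      have h1 := mem_along_itin hy
      rw [hl] at h1 ⊢
      exact div_pos (itinMult_pos ⟨y, h1⟩) (itinValue_pos _)
  · conv => arg 2; rw [paths_eq_biUnion]
    refine Growth.biUnion ?_ ?_
    · intro σ hσ τ hτ hne
      rw [Set.Finite.mem_toFinset] at hσ hτ
      obtain ⟨x, hx, rfl⟩ := hσ
      obtain ⟨y, hy, rfl⟩ := hτ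
      rw [along_itin hx, along_itin hy, Set.disjoint_left]
      exact fun z hz hz' => hne (hz.2.symm.trans hz'.2)
    · intro σ hσ
      rw [Set.Finite.mem_toFinset] at hσ
      obtain ⟨x, hx, rfl⟩ := hσ
      have h2 := fun q hq => (hcyc _ (isSCCOn_of_mem_innerSteps hx (q := q) hq)).deterministic
      have h3 := (length_innerSteps_le_numSCC hx).trans (hc.2 ⟨x, hx, rfl⟩)
      obtain ⟨l, hl, hr⟩ := exists_itin_eq_cons hx
      rw [hl] at h2 h3 ⊢
      have h4 := growth_along hr h2
      split
      · next h => rwa [h] at h4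
      · next h => exact h4.of_lt (lt_of_le_of_ne h3 h)

end WeightedDigraph
end

noncomputable section

/-! ### Powers of nonnegative matrices -/

section NonnegMatrix

open scoped NNReal ENNReal

variable {V : Type*} [Fintype V] [DecidableEq V]

theorem Matrix.pow_apply_le_of_le {B C : Matrix V V ℝ} {t : ℝ}
    (hC : ∀ i j, 0 ≤ C i j) (h : ∀ i j, C i j ≤ t * B i j) (n : ℕ) (i j : V) :
    (C ^ n) i j ≤ t ^ n * (B ^ n) i j := by
  induction n generalizing i j with
  | zero => simp
  | succ n ih =>
    rw [pow_succ, Matrix.mul_apply, pow_succ, pow_succ, Matrix.mul_apply, Finset.mul_sum]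
    refine Finset.sum_le_sum fun k _ => ?_
    calc (C ^ n) i k * C k j ≤ (t ^ n * (B ^ n) i k) * (t * B k j) :=
          mul_le_mul (ih i k) (h k j) (hC k j) ((pow_apply_nonneg hC n i k).trans (ih i k))
      _ = _ := by ring

theorem Matrix.mul_le_pow_add_apply {B : Matrix V V ℝ} (hB : ∀ i j, 0 ≤ B i j) (m n : ℕ)
    (i j k : V) : (B ^ m) i j * (B ^ n) j k ≤ (B ^ (m + n)) i k := by
  rw [pow_add, Matrix.mul_apply]
  exact Finset.single_le_sum (f := fun j => (B ^ m) i j * (B ^ n) j k)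
    (fun j _ => mul_nonneg (pow_apply_nonneg hB m i j) (pow_apply_nonneg hB n j k))
    (Finset.mem_univ j)

theorem Matrix.apply_pow_le_pow_apply {B : Matrix V V ℝ} (hB : ∀ i j, 0 ≤ B i j) (m n : ℕ)
    (i : V) : ((B ^ m) i i) ^ n ≤ (B ^ (m * n)) i i := by
  induction n with
  | zero => simp
  | succ n ih =>
    rw [pow_succ, Nat.mul_succ]
    exact (mul_le_mul_of_nonneg_right ih (pow_apply_nonneg hB m i i)).trans
      (mul_le_pow_add_apply hB _ _ i i i)

/-- The spectral radius of a real matrix, over the complex numbers. -/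
def Matrix.radius (B : Matrix V V ℝ) : ℝ≥0∞ := spectralRadius ℂ (B.map Complex.ofReal)

attribute [local instance] Matrix.linftyOpNormedRing Matrix.linftyOpNormedAlgebra
  Matrix.linftyOpNormedAddCommGroup Matrix.linftyOpNormedSpace

theorem Matrix.map_ofReal_pow (B : Matrix V V ℝ) (n : ℕ) :
    (B.map Complex.ofReal) ^ n = (B ^ n).map Complex.ofReal :=
  (map_pow (Complex.ofRealHom.mapMatrix) B n).symm

theorem Matrix.apply_le_norm_map (B : Matrix V V ℝ) (i j : V) :
    B i j ≤ ‖B.map Complex.ofReal‖ := by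
  have h1 : ‖B i j‖₊ ≤ ‖B.map Complex.ofReal‖₊ := by
    rw [Matrix.linfty_opNNNorm_def]
    refine le_trans ?_ (Finset.le_sup (Finset.mem_univ i))
    refine le_trans (le_of_eq ?_) (Finset.single_le_sum (fun j _ => zero_le) (Finset.mem_univ j))
    simp
  exact (le_abs_self _).trans (by exact_mod_cast h1)

theorem Matrix.nnnorm_map_le {B C : Matrix V V ℝ} {t : ℝ≥0} (hC : ∀ i j, 0 ≤ C i j)
    (h : ∀ i j, C i j ≤ t * B i j) :
    ‖C.map Complex.ofReal‖₊ ≤ t * ‖B.map Complex.ofReal‖₊ := by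
  rw [Matrix.linfty_opNNNorm_def, Matrix.linfty_opNNNorm_def]
  refine Finset.sup_le fun i _ => ?_
  refine le_trans ?_ (mul_le_mul_right (Finset.le_sup (Finset.mem_univ i)) t)
  rw [Finset.mul_sum]
  refine Finset.sum_le_sum fun j _ => ?_
  rw [← NNReal.coe_le_coe]
  simp only [Matrix.map_apply, Complex.nnnorm_real, NNReal.coe_mul, coe_nnnorm, Real.norm_eq_abs]
  rw [abs_of_nonneg (hC i j)]
  exact (h i j).trans (mul_le_mul_of_nonneg_left (le_abs_self _) t.2)

theorem Matrix.norm_map_le_sum {B : Matrix V V ℝ} (hB : ∀ i j, 0 ≤ B i j) :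
    ‖B.map Complex.ofReal‖ ≤ ∑ i, ∑ j, B i j := by
  have h : ‖B.map Complex.ofReal‖₊ ≤ ∑ i, ∑ j, ‖B i j‖₊ := by
    rw [Matrix.linfty_opNNNorm_def]
    refine Finset.sup_le fun i _ => ?_
    simp only [Matrix.map_apply, Complex.nnnorm_real]
    exact Finset.single_le_sum (f := fun i => ∑ j, ‖B i j‖₊) (fun j _ => zero_le)
      (Finset.mem_univ i)
  rw [← NNReal.coe_le_coe] at h
  push_cast at h
  refine h.trans (le_of_eq ?_)
  refine Finset.sum_congr rfl fun i _ => Finset.sum_congr rfl fun j _ => ?_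
  rw [Real.norm_eq_abs, abs_of_nonneg (hB i j)]

theorem Matrix.tendsto_radius (B : Matrix V V ℝ) :
    Tendsto (fun n : ℕ => (‖(B ^ n).map Complex.ofReal‖₊ : ℝ≥0∞) ^ (1 / n : ℝ)) atTop
      (𝓝 B.radius) := by
  have := spectrum.pow_nnnorm_pow_one_div_tendsto_nhds_spectralRadius (B.map Complex.ofReal)
  simp only [Matrix.map_ofReal_pow] at this
  exact this

theorem Matrix.eventually_norm_le {B : Matrix V V ℝ} {q : ℝ≥0} (h : B.radius < q) :
    ∀ᶠ n : ℕ in atTop, ‖(B ^ n).map Complex.ofReal‖ ≤ (q : ℝ) ^ n := by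
  filter_upwards [B.tendsto_radius.eventually_lt_const h, eventually_gt_atTop 0] with n hn hn0
  have h1 := ENNReal.rpow_le_rpow hn.le (Nat.cast_nonneg n : (0 : ℝ) ≤ n)
  rw [← ENNReal.rpow_mul, one_div_mul_cancel (by positivity), ENNReal.rpow_one,
    ENNReal.rpow_natCast] at h1
  exact_mod_cast h1

theorem Matrix.eventually_le_norm {B : Matrix V V ℝ} {q : ℝ≥0} (h : q < B.radius) :
    ∀ᶠ n : ℕ in atTop, (q : ℝ) ^ n ≤ ‖(B ^ n).map Complex.ofReal‖ := by
  filter_upwards [B.tendsto_radius.eventually_const_lt h, eventually_gt_atTop 0] with n hn hn0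
  have h1 := ENNReal.rpow_le_rpow hn.le (Nat.cast_nonneg n : (0 : ℝ) ≤ n)
  rw [← ENNReal.rpow_mul, one_div_mul_cancel (by positivity), ENNReal.rpow_one,
    ENNReal.rpow_natCast] at h1
  exact_mod_cast h1

theorem Matrix.radius_le_of_le {B C : Matrix V V ℝ} {t : ℝ≥0} (hC : ∀ i j, 0 ≤ C i j)
    (h : ∀ i j, C i j ≤ t * B i j) : C.radius ≤ t * B.radius := by
  refine le_of_tendsto_of_tendsto C.tendsto_radius
    (ENNReal.Tendsto.const_mul B.tendsto_radius (Or.inr ENNReal.coe_ne_top)) ?_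
  filter_upwards [eventually_gt_atTop 0] with n hn
  have h1 : ‖(C ^ n).map Complex.ofReal‖₊ ≤ t ^ n * ‖(B ^ n).map Complex.ofReal‖₊ := by
    refine nnnorm_map_le (pow_apply_nonneg hC n) fun i j => ?_
    push_cast
    exact pow_apply_le_of_le hC h n i j
  have h2 : (‖(C ^ n).map Complex.ofReal‖₊ : ℝ≥0∞)
      ≤ (t : ℝ≥0∞) ^ n * ‖(B ^ n).map Complex.ofReal‖₊ := by exact_mod_cast h1
  refine (ENNReal.rpow_le_rpow h2 (by positivity)).trans (le_of_eq ?_)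
  rw [ENNReal.mul_rpow_of_nonneg _ _ (by positivity), ← ENNReal.rpow_natCast, ← ENNReal.rpow_mul,
    mul_one_div_cancel (by positivity), ENNReal.rpow_one]

theorem Matrix.radius_lt_top (B : Matrix V V ℝ) : B.radius < ⊤ := by
  refine (spectrum.spectralRadius_le_pow_nnnorm_pow_one_div ℂ (B.map Complex.ofReal) 0).trans_lt ?_
  exact ENNReal.mul_lt_top (by simp) (by simp)

theorem Matrix.radius_lt_one_of_row_sum [Nonempty V] {B : Matrix V V ℝ} (hB : ∀ i j, 0 ≤ B i j)
    (h : ∀ i, ∑ j, B i j < 1) : B.radius < 1 := by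
  have h1 : ‖B.map Complex.ofReal‖₊ < 1 := by
    rw [Matrix.linfty_opNNNorm_def, Finset.sup_lt_iff (by simp)]
    intro i _
    rw [← NNReal.coe_lt_coe]
    push_cast
    refine lt_of_eq_of_lt (Finset.sum_congr rfl fun j _ => ?_) (h i)
    simp [abs_of_nonneg (hB i j)]
  exact (spectrum.spectralRadius_le_nnnorm _).trans_lt (by exact_mod_cast h1)

theorem Matrix.summable_pow_apply {B : Matrix V V ℝ} (hB : ∀ i j, 0 ≤ B i j) (h : B.radius < 1)
    (i j : V) : Summable fun n => (B ^ n) i j := by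
  obtain ⟨q, hq, hq1⟩ := ENNReal.lt_iff_exists_nnreal_btwn.1 h
  refine Summable.of_norm_bounded_eventually_nat
    (summable_geometric_of_lt_one q.2 (by exact_mod_cast hq1)) ?_
  filter_upwards [eventually_norm_le hq] with n hn
  rw [Real.norm_eq_abs, abs_of_nonneg (pow_apply_nonneg hB n i j)]
  exact (apply_le_norm_map _ i j).trans hn

theorem Matrix.one_lt_radius {B : Matrix V V ℝ} (hB : ∀ i j, 0 ≤ B i j) {m : ℕ} {i : V}
    (hm : 0 < m) (h : 1 < (B ^ m) i i) : 1 < B.radius := by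
  by_contra! hle
  obtain ⟨r, hr1, hr⟩ := exists_between h
  have hr0 : 0 ≤ r := by linarith
  obtain ⟨q, hqr⟩ : ∃ q : ℝ≥0, (q : ℝ) = r ^ (1 / m : ℝ) :=
    ⟨_, Real.coe_toNNReal _ (by positivity)⟩
  have hq : 1 < q := by
    rw [← NNReal.coe_lt_coe, hqr]
    exact Real.one_lt_rpow hr1 (by positivity)
  have hqm : (q : ℝ) ^ m = r := by
    rw [hqr, ← Real.rpow_natCast, ← Real.rpow_mul hr0, one_div_mul_cancel (by positivity),
      Real.rpow_one]
  have h1 := eventually_norm_le (hle.trans_lt (by exact_mod_cast hq : (1 : ℝ≥0∞) < q))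
  obtain ⟨n, hn⟩ := eventually_atTop.1 h1
  have h2 := hn (m * (n + 1)) (by nlinarith)
  have h3 := (apply_pow_le_pow_apply hB m (n + 1) i).trans ((apply_le_norm_map _ i i).trans h2)
  rw [pow_mul, hqm] at h3
  exact absurd h3 (not_le.2 (pow_lt_pow_left₀ hr hr0 (by omega)))

theorem Matrix.exists_le_pow_apply {B : Matrix V V ℝ} (hB : ∀ i j, 0 ≤ B i j)
    (h : 1 < B.radius) (K : ℝ) : ∃ n, 0 < n ∧ ∃ i j, K ≤ (B ^ n) i j := by
  obtain ⟨q, hq1, hq⟩ := ENNReal.lt_iff_exists_nnreal_btwn.1 h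
  have hq1' : (1 : ℝ) < q := by exact_mod_cast hq1
  obtain ⟨n, hn, hn0, hnK⟩ := ((eventually_le_norm hq).and ((eventually_gt_atTop 0).and
    ((tendsto_pow_atTop_atTop_of_one_lt hq1').eventually_gt_atTop (∑ _i : V, ∑ _j : V, K)))).exists
  refine ⟨n, hn0, ?_⟩
  by_contra! hlt
  have h1 := norm_map_le_sum (pow_apply_nonneg hB n)
  have h2 : ∑ i, ∑ j, (B ^ n) i j ≤ ∑ _i : V, ∑ _j : V, K :=
    Finset.sum_le_sum fun i _ => Finset.sum_le_sum fun j _ => (hlt i j).le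
  linarith

end NonnegMatrix
end

noncomputable section

namespace WeightedDigraph

open scoped NNReal ENNReal

variable {V E : Type*} (G : WeightedDigraph V E)

/-! ### The matrix of exponential weights -/

open scoped Classical in
/-- The matrix whose `(i, j)` entry is the sum of `exp (- l * W e)` over the edges `e` from `j`
to `i`. -/
def expMatrix [Fintype E] (l : ℝ) : Matrix V V ℝ :=
  Matrix.of fun i j => ∑ e with G.I e = j ∧ G.O e = i, Real.exp (-(l * G.W e))

open scoped Classical in
/-- The walks of length `n` from `j` to `i`. -/
def walkFinset [Fintype E] (i : V) : ℕ → V → Finset (List E)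
  | 0, j => if j = i then {[]} else ∅
  | n + 1, j => (Finset.univ.filter fun e => G.I e = j).biUnion fun e =>
      (walkFinset i n (G.O e)).image (List.cons e)

variable {G}

theorem mem_walkFinset [Fintype E] {i j : V} {n : ℕ} {x : List E} :
    x ∈ G.walkFinset i n j ↔ G.Walk j x i ∧ x.length = n := by
  classical
  induction n generalizing j x with
  | zero =>
    rw [walkFinset]
    split_ifs with h
    · subst h
      cases x <;> simp
    · cases x <;> simp [h]
  | succ n ih =>
    simp only [walkFinset, Finset.mem_biUnion, Finset.mem_filter, Finset.mem_univ, true_and,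
      Finset.mem_image, ih]
    constructor
    · rintro ⟨e, rfl, y, ⟨hy, rfl⟩, rfl⟩
      exact ⟨⟨rfl, hy⟩, rfl⟩
    · rintro ⟨hx, hn⟩
      cases x with
      | nil => simp at hn
      | cons e x => exact ⟨e, hx.1, x, ⟨hx.2, by simpa using hn⟩, rfl⟩

section

variable [Fintype E]

theorem expMatrix_nonneg (l : ℝ) (i j : V) : 0 ≤ G.expMatrix l i j :=
  Finset.sum_nonneg fun _ _ => (Real.exp_pos _).le

variable (G) in
theorem exists_le_W : ∃ a > 0, ∀ e, a ≤ G.W e := by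
  cases isEmpty_or_nonempty E with
  | inl _ => exact ⟨1, one_pos, fun e => isEmptyElim e⟩
  | inr _ =>
    obtain ⟨e, he⟩ := Finite.exists_min G.W
    exact ⟨_, G.W_pos e, he⟩

variable (G) in
theorem exists_W_le : ∃ b : ℝ≥0, ∀ e, G.W e ≤ b :=
  ⟨⟨∑ e, G.W e, Finset.sum_nonneg fun e _ => (G.W_pos e).le⟩, fun e =>
    Finset.single_le_sum (f := G.W) (fun e _ => (G.W_pos e).le) (Finset.mem_univ e)⟩

theorem exists_two_closed_walks (hG : ∀ u v, G.Conn u v) (hcyc : ¬ G.IsCycle) :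
    ∃ v x y, G.Walk v x v ∧ G.Walk v y v ∧ x.length = y.length ∧ 0 < x.length ∧ x ≠ y := by
  have hwalk : ∀ u v, ∃ x, G.Walk u x v := fun u v => by
    obtain ⟨x, hx⟩ := (hG u v).1
    exact ⟨x, (mem_paths_iff.1 hx).2⟩
  rw [IsCycle, not_and] at hcyc
  have := hcyc hG
  push Not at this
  obtain ⟨v, hv⟩ := this
  obtain ⟨p, hp⟩ := (hG v v).1
  obtain ⟨hp0, hp⟩ := mem_paths_iff.1 hp
  by_cases hin : {e | G.O e = v}.ncard = 1
  · have hpos : 0 < {e | G.I e = v}.ncard := by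
      refine (Set.ncard_pos (Set.toFinite _)).2 ?_
      cases p with
      | nil => simp at hp0
      | cons e p => exact ⟨e, hp.1⟩
    obtain ⟨e, f, he, hf, hef⟩ := (Set.one_lt_ncard_iff (Set.toFinite _)).1
      (lt_of_le_of_ne hpos (hv hin).symm)
    obtain ⟨x, hx⟩ := hwalk (G.O e) v
    obtain ⟨y, hy⟩ := hwalk (G.O f) v
    have h1 : G.Walk v (e :: x) v := ⟨he, hx⟩
    have h2 : G.Walk v (f :: y) v := ⟨hf, hy⟩
    refine ⟨v, e :: x ++ f :: y, f :: y ++ e :: x, h1.append h2, h2.append h1, ?_, by simp, ?_⟩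
    · simp; omega
    · intro h
      exact hef (List.cons.inj h).1
  · have hpos : 0 < {e | G.O e = v}.ncard := by
      refine (Set.ncard_pos (Set.toFinite _)).2 ?_
      obtain ⟨p, e, rfl⟩ := p.eq_nil_or_concat.resolve_left hp0
      rw [List.concat_eq_append, walk_append] at hp
      obtain ⟨b, -, -, h⟩ := hp
      exact ⟨e, h⟩
    obtain ⟨e, f, he, hf, hef⟩ := (Set.one_lt_ncard_iff (Set.toFinite _)).1
      (lt_of_le_of_ne hpos (Ne.symm hin))
    obtain ⟨x, hx⟩ := hwalk v (G.I e)
    obtain ⟨y, hy⟩ := hwalk v (G.I f)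
    have h1 : G.Walk v (x ++ [e]) v := hx.append ⟨rfl, he⟩
    have h2 : G.Walk v (y ++ [f]) v := hy.append ⟨rfl, hf⟩
    refine ⟨v, (x ++ [e]) ++ (y ++ [f]), (y ++ [f]) ++ (x ++ [e]), h1.append h2, h2.append h1,
      ?_, by simp, ?_⟩
    · simp; omega
    · intro h
      rw [← List.append_assoc, ← List.append_assoc _ x] at h
      exact hef (List.singleton_inj.1 (List.append_inj' h rfl).2).symm

variable [Fintype V]

open scoped Classical in
theorem expMatrix_pow_apply (l : ℝ) (n : ℕ) (i j : V) :
    (G.expMatrix l ^ n) i j = ∑ x ∈ G.walkFinset i n j, Real.exp (-(l * G.weight x)) := by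
  induction n generalizing j with
  | zero =>
    rw [pow_zero, Matrix.one_apply, walkFinset]
    by_cases h : i = j
    · simp [h]
    · simp [h, Ne.symm h]
  | succ n ih =>
    rw [pow_succ, Matrix.mul_apply, walkFinset, Finset.sum_biUnion]
    · calc ∑ k, (G.expMatrix l ^ n) i k * G.expMatrix l k j
          = ∑ k, ∑ e with G.I e = j, if G.O e = k then
              (G.expMatrix l ^ n) i k * Real.exp (-(l * G.W e)) else 0 := by
            refine Finset.sum_congr rfl fun k _ => ?_
            rw [expMatrix, Matrix.of_apply, Finset.mul_sum, ← Finset.sum_filter,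
              Finset.filter_filter]
        _ = ∑ e with G.I e = j, (G.expMatrix l ^ n) i (G.O e) * Real.exp (-(l * G.W e)) := by
            rw [Finset.sum_comm]
            refine Finset.sum_congr rfl fun e _ => ?_
            simp
        _ = _ := by
            refine Finset.sum_congr rfl fun e _ => ?_
            rw [Finset.sum_image fun _ _ _ _ h => List.cons_injective h, ih, Finset.sum_mul]
            refine Finset.sum_congr rfl fun x _ => ?_
            rw [← Real.exp_add, weight_cons]
            ring_nf
    · intro e _ f _ hef
      rw [Function.onFun, Finset.disjoint_left]
      intro x hx hx'
      obtain ⟨y, -, rfl⟩ := Finset.mem_image.1 hx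
      obtain ⟨z, -, hz⟩ := Finset.mem_image.1 hx'
      exact hef (List.cons.inj hz).1.symm

variable (G) in
open scoped Classical in
/-- The spectral radius of the matrix of exponential weights. -/
def expRadius (l : ℝ) : ℝ≥0∞ := (G.expMatrix l).radius

theorem isDecayConst_iff {s : ℝ} : G.IsDecayConst s ↔ 0 < s ∧ G.expRadius s⁻¹ = 1 := by
  classical
  have h : G.decayMatrix s = (G.expMatrix s⁻¹).map Complex.ofReal := by
    ext i j
    simp [decayMatrix, expMatrix]
  rw [IsDecayConst, h, expRadius, Matrix.radius]

theorem expRadius_le {l l' t : ℝ} (h : ∀ e, t ≤ (l' - l) * G.W e) :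
    G.expRadius l' ≤ ENNReal.ofReal (Real.exp (-t)) * G.expRadius l := by
  classical
  refine Matrix.radius_le_of_le (expMatrix_nonneg l') fun i j => ?_
  rw [Real.coe_toNNReal _ (Real.exp_pos _).le, expMatrix, expMatrix, Matrix.of_apply,
    Matrix.of_apply, Finset.mul_sum]
  refine Finset.sum_le_sum fun e _ => ?_
  rw [← Real.exp_add]
  exact Real.exp_le_exp.2 (by linarith [h e])

theorem expRadius_lt_top (l : ℝ) : G.expRadius l < ⊤ := by
  classical exact Matrix.radius_lt_top _

theorem expRadius_lt_one {l l' : ℝ} (h : G.expRadius l = 1) (hl : l < l') :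
    G.expRadius l' < 1 := by
  obtain ⟨a, ha, haW⟩ := G.exists_le_W
  have hpos : 0 < (l' - l) * a := mul_pos (sub_pos.2 hl) ha
  have h1 := expRadius_le (G := G) (l := l) (l' := l') (t := (l' - l) * a)
    fun e => mul_le_mul_of_nonneg_left (haW e) (sub_pos.2 hl).le
  rw [h, mul_one] at h1
  refine h1.trans_lt ?_
  rw [ENNReal.ofReal_lt_one]
  exact Real.exp_lt_one_iff.2 (by linarith)

theorem one_lt_expRadius {l l' : ℝ} (h : G.expRadius l = 1) (hl : l' < l) :
    1 < G.expRadius l' := by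
  obtain ⟨a, ha, haW⟩ := G.exists_le_W
  have hpos : 0 < (l - l') * a := mul_pos (sub_pos.2 hl) ha
  have h1 := expRadius_le (G := G) (l := l') (l' := l) (t := (l - l') * a)
    fun e => mul_le_mul_of_nonneg_left (haW e) (sub_pos.2 hl).le
  rw [h] at h1
  by_contra! h2
  have h3 : ENNReal.ofReal (Real.exp (-((l - l') * a))) * G.expRadius l' < 1 := by
    refine (mul_le_mul_right h2 _).trans_lt ?_
    rw [mul_one, ENNReal.ofReal_lt_one]
    exact Real.exp_lt_one_iff.2 (by linarith)
  exact absurd h1 (not_le.2 h3)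

theorem IsCycle.expRadius_lt_one [Nonempty V] (h : G.IsCycle) {l : ℝ} (hl : 0 < l) :
    G.expRadius l < 1 := by
  classical
  refine Matrix.radius_lt_one_of_row_sum (expMatrix_nonneg l) fun i => ?_
  obtain ⟨f, hf⟩ := Set.ncard_eq_one.1 (h.2 i).1
  have hf' : ∀ e, G.O e = i ↔ e = f := fun e => by
    rw [← Set.mem_singleton_iff (b := f), ← hf]
    rfl
  calc ∑ j, G.expMatrix l i j
      = ∑ j, ∑ e, if G.I e = j then (if G.O e = i then Real.exp (-(l * G.W e)) else 0) else 0 := by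
        refine Finset.sum_congr rfl fun j _ => ?_
        rw [expMatrix, Matrix.of_apply, Finset.sum_filter]
        refine Finset.sum_congr rfl fun e _ => ?_
        rw [ite_and]
    _ = Real.exp (-(l * G.W f)) := by
        rw [Finset.sum_comm]
        simp [hf']
    _ < 1 := Real.exp_lt_one_iff.2 (by have := mul_pos hl (G.W_pos f); linarith)

/-! ### Strongly connected graphs that are not cycles -/

theorem one_lt_expRadius_zero (hG : ∀ u v, G.Conn u v) (hcyc : ¬ G.IsCycle) :
    1 < G.expRadius 0 := by
  classical
  obtain ⟨v, x, y, hx, hy, hxy, hx0, hne⟩ := exists_two_closed_walks hG hcyc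
  refine Matrix.one_lt_radius (expMatrix_nonneg 0) hx0 (i := v) ?_
  rw [expMatrix_pow_apply]
  have : 1 < (G.walkFinset v x.length v).card := Finset.one_lt_card.2
    ⟨x, mem_walkFinset.2 ⟨hx, rfl⟩, y, mem_walkFinset.2 ⟨hy, hxy.symm⟩, hne⟩
  simpa using this

theorem existsUnique_isDecayConst (hG : ∀ u v, G.Conn u v) (hcyc : ¬ G.IsCycle) :
    ∃! s, G.IsDecayConst s := by
  obtain ⟨a, ha, haW⟩ := G.exists_le_W
  obtain ⟨b, hbW⟩ := G.exists_W_le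
  have hlow : ∀ l l', l ≤ l' →
      G.expRadius l' ≤ ENNReal.ofReal (Real.exp (-((l' - l) * a))) * G.expRadius l :=
    fun l l' h => expRadius_le fun e => mul_le_mul_of_nonneg_left (haW e) (sub_nonneg.2 h)
  have hupp : ∀ l l', l ≤ l' →
      G.expRadius l ≤ ENNReal.ofReal (Real.exp (-((l - l') * b))) * G.expRadius l' :=
    fun l l' h => expRadius_le fun e => mul_le_mul_of_nonpos_left (hbW e) (sub_nonpos.2 h)
  have h0 := one_lt_expRadius_zero hG hcyc
  have hpos : ∀ l, 0 < G.expRadius l := by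
    intro l
    rw [pos_iff_ne_zero]
    intro hl
    rcases le_total 0 l with h | h
    · have h1 := hupp 0 l h
      rw [hl, mul_zero] at h1
      exact absurd h0 (not_lt.2 (h1.trans zero_le_one))
    · have h1 := hlow l 0 h
      rw [hl, mul_zero] at h1
      exact absurd h0 (not_lt.2 (h1.trans zero_le_one))
  set g : ℝ → ℝ := fun l => Real.log (G.expRadius l).toReal with hg
  have hlog : ∀ l l' t, G.expRadius l ≤ ENNReal.ofReal (Real.exp (-t)) * G.expRadius l' →
      g l ≤ g l' - t := by
    intro l l' t h
    have h1 : (G.expRadius l).toReal ≤ Real.exp (-t) * (G.expRadius l').toReal := by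
      have := ENNReal.toReal_mono (ENNReal.mul_lt_top (by simp) (expRadius_lt_top l')).ne h
      rwa [ENNReal.toReal_mul, ENNReal.toReal_ofReal (Real.exp_pos _).le] at this
    have hp : ∀ l, 0 < (G.expRadius l).toReal := fun l =>
      ENNReal.toReal_pos (hpos l).ne' (expRadius_lt_top l).ne
    have h2 := Real.log_le_log (hp l) h1
    rw [Real.log_mul (Real.exp_pos _).ne' (hp l').ne', Real.log_exp] at h2
    simp only [hg]
    linarith
  have hgcont : Continuous g := by
    refine (LipschitzWith.of_le_add_mul b fun l l' => ?_).continuous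
    rw [Real.dist_eq]
    rcases le_total l l' with h | h
    · have := hlog _ _ _ (hupp l l' h)
      rw [abs_of_nonpos (sub_nonpos.2 h)]
      linarith
    · have := hlog _ _ _ (hlow l' l h)
      have h1 : 0 ≤ (l - l') * a := mul_nonneg (sub_nonneg.2 h) ha.le
      have h2 : 0 ≤ (b : ℝ) * |l - l'| := by positivity
      linarith
  have hg0 : 0 < g 0 := by
    refine Real.log_pos ?_
    rw [← ENNReal.toReal_one]
    exact ENNReal.toReal_strict_mono (expRadius_lt_top 0).ne h0
  set L := g 0 / a with hL
  have hL0 : 0 ≤ L := by positivity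
  have hgL : g L ≤ 0 := by
    have := hlog _ _ _ (hlow 0 L hL0)
    rw [sub_zero, hL, div_mul_cancel₀ _ ha.ne', sub_self] at this
    exact this
  obtain ⟨l, ⟨hl0, -⟩, hl⟩ := intermediate_value_Icc' hL0 hgcont.continuousOn ⟨hgL, hg0.le⟩
  have hl0' : 0 < l := lt_of_le_of_ne hl0 (by rintro rfl; exact hg0.ne' hl)
  have hl1 : G.expRadius l = 1 := by
    have h1 := Real.exp_log (ENNReal.toReal_pos (hpos l).ne' (expRadius_lt_top l).ne)
    have h2 : Real.log (G.expRadius l).toReal = 0 := hl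
    rw [h2, Real.exp_zero] at h1
    rw [← ENNReal.ofReal_toReal (expRadius_lt_top l).ne, ← h1, ENNReal.ofReal_one]
  refine ⟨l⁻¹, isDecayConst_iff.2 ⟨inv_pos.2 hl0', by rwa [inv_inv]⟩, fun s hs => ?_⟩
  obtain ⟨hs0, hs⟩ := isDecayConst_iff.1 hs
  rcases lt_trichotomy s⁻¹ l with h | h | h
  · exact absurd hl1 (expRadius_lt_one hs h).ne
  · rw [← h, inv_inv]
  · exact absurd hs (expRadius_lt_one hl1 h).ne

/-! ### Exponential growth of the number of closed walks -/

theorem exists_one_le_sum_closed (hG : ∀ u v, G.Conn u v) {l : ℝ} (hl : 1 < G.expRadius l) :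
    ∃ n v, 0 < n ∧ 1 ≤ ∑ x ∈ G.walkFinset v n v, Real.exp (-(l * G.weight x)) := by
  classical
  have h1 : ∀ q : V × V, ∃ x, G.Walk q.1 x q.2 := fun q => by
    obtain ⟨x, hx⟩ := (hG q.1 q.2).1
    exact ⟨x, (mem_paths_iff.1 hx).2⟩
  choose y hy using h1
  obtain ⟨n, hn, i, j, hij⟩ := Matrix.exists_le_pow_apply (expMatrix_nonneg (G := G) l) hl
    (∑ q, Real.exp (l * G.weight (y q)))
  refine ⟨n + (y (i, j)).length, i, by omega, ?_⟩
  rw [← expMatrix_pow_apply]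
  refine le_trans ?_ (Matrix.mul_le_pow_add_apply (expMatrix_nonneg l) _ _ i j i)
  have h2 : Real.exp (-(l * G.weight (y (i, j)))) ≤ (G.expMatrix l ^ (y (i, j)).length) j i := by
    rw [expMatrix_pow_apply]
    exact Finset.single_le_sum (f := fun x => Real.exp (-(l * G.weight x)))
      (fun _ _ => (Real.exp_pos _).le) (mem_walkFinset.2 ⟨hy (i, j), rfl⟩)
  have h3 : Real.exp (l * G.weight (y (i, j))) ≤ (G.expMatrix l ^ n) i j :=
    (Finset.single_le_sum (f := fun q => Real.exp (l * G.weight (y q)))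
      (fun _ _ => (Real.exp_pos _).le) (Finset.mem_univ _)).trans hij
  calc (1 : ℝ) = Real.exp (l * G.weight (y (i, j))) * Real.exp (-(l * G.weight (y (i, j)))) := by
        rw [← Real.exp_add]; simp
    _ ≤ _ := mul_le_mul h3 h2 (Real.exp_pos _).le ((Real.exp_pos _).le.trans h3)

/-- The number of closed walks grows exponentially. -/
theorem exists_exp_le_count (hG : ∀ u v, G.Conn u v) {l : ℝ} (hl0 : 0 < l)
    (hl : 1 < G.expRadius l) : ∃ v, ∃ M : ℝ, ∀ t, 0 ≤ t →
      Real.exp (l * (t - M)) ≤ G.count {x | G.Walk v x v} t := by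
  classical
  obtain ⟨n, v, hn, hsum⟩ := exists_one_le_sum_closed hG hl
  obtain ⟨a, ha, haW⟩ := G.exists_le_W
  set K := G.walkFinset v n v with hK
  set M := ∑ x ∈ K, G.weight x with hM
  have hxM : ∀ x ∈ K, G.weight x ≤ M := fun x hx =>
    Finset.single_le_sum (f := G.weight) (fun x _ => G.weight_nonneg x) hx
  have hxa : ∀ x ∈ K, a ≤ G.weight x := by
    intro x hx
    obtain ⟨-, h⟩ := mem_walkFinset.1 hx
    cases x with
    | nil => simp at h; omega
    | cons e x => have := G.weight_nonneg x; have := haW e; rw [weight_cons]; linarith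
  have hrec : ∀ t, ∑ x ∈ K, G.count {x | G.Walk v x v} (t - G.weight x)
      ≤ G.count {x | G.Walk v x v} t := by
    intro t
    simp only [← count_image_append]
    rw [← count_biUnion]
    · refine count_mono_set ?_ t
      rw [Set.iUnion₂_subset_iff]
      rintro x hx _ ⟨y, hy, rfl⟩
      exact (mem_walkFinset.1 hx).1.append hy
    · intro x hx y hy hxy
      rw [Set.disjoint_left]
      rintro _ ⟨z, -, rfl⟩ ⟨z', -, h⟩
      refine hxy (List.append_inj h ?_).1.symm
      rw [(mem_walkFinset.1 hx).2, (mem_walkFinset.1 hy).2]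
  refine ⟨v, M, ?_⟩
  have key : ∀ t, 0 ≤ t → ∀ t', 0 ≤ t' → t' ≤ t →
      Real.exp (l * (t' - M)) ≤ G.count {x | G.Walk v x v} t' := by
    refine induction_step ha (fun t ht ht' => absurd ht' (not_le.2 ht)) fun t ht ih _ => ?_
    intro t' ht' htt'
    rcases le_or_gt t' M with h | h
    · have h1 : 1 ≤ G.count {x | G.Walk v x v} t' := by
        refine (Set.ncard_pos (finite_count _ _)).2 ⟨[], rfl, ?_⟩
        simpa using ht'
      have h2 : Real.exp (l * (t' - M)) ≤ 1 :=
        Real.exp_le_one_iff.2 (mul_nonpos_of_nonneg_of_nonpos hl0.le (by linarith))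
      exact h2.trans (by exact_mod_cast h1)
    · have h1 : ∑ x ∈ K, Real.exp (l * (t' - G.weight x - M))
          ≤ ∑ x ∈ K, (G.count {x | G.Walk v x v} (t' - G.weight x) : ℝ) := by
        refine Finset.sum_le_sum fun x hx => ?_
        have h2 := hxM x hx
        have h3 := hxa x hx
        exact ih (by linarith) _ (by linarith) (by linarith)
      have h4 : ∑ x ∈ K, Real.exp (l * (t' - G.weight x - M))
          = Real.exp (l * (t' - M)) * ∑ x ∈ K, Real.exp (-(l * G.weight x)) := by
        rw [Finset.mul_sum]
        refine Finset.sum_congr rfl fun x _ => ?_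
        rw [← Real.exp_add]
        ring_nf
      rw [h4] at h1
      calc Real.exp (l * (t' - M))
          ≤ Real.exp (l * (t' - M)) * ∑ x ∈ K, Real.exp (-(l * G.weight x)) :=
            le_mul_of_one_le_right (Real.exp_pos _).le hsum
        _ ≤ _ := h1
        _ ≤ _ := by exact_mod_cast hrec t'
  exact fun t ht => key t ht t ht le_rfl

end

end WeightedDigraph
end

noncomputable section

namespace WeightedDigraph

open scoped NNReal ENNReal

variable {V E : Type*} {G : WeightedDigraph V E}

/-! ### Components as induced graphs -/

theorem Walk.map_val {C : Set V} {u v : C} {x : List {e : E // G.I e ∈ C ∧ G.O e ∈ C}}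
    (h : (G.induce C).Walk u x v) : G.Walk u.1 (x.map Subtype.val) v.1 := by
  induction x generalizing u with
  | nil => exact congrArg Subtype.val h
  | cons e x ih => exact ⟨congrArg Subtype.val h.1, ih h.2⟩

theorem Walk.exists_lift {C : Set V} {u v : V} {x : List E} (h : G.Walk u x v) (hu : u ∈ C)
    (hv : v ∈ C) (hx : ∀ e ∈ x, G.I e ∈ C ∧ G.O e ∈ C) :
    ∃ y, (G.induce C).Walk ⟨u, hu⟩ y ⟨v, hv⟩ ∧ y.map Subtype.val = x := by
  induction x generalizing u with
  | nil => exact ⟨[], Subtype.ext h, rfl⟩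
  | cons e x ih =>
    obtain ⟨rfl, h⟩ := h
    obtain ⟨h1, h2⟩ := hx e (by simp)
    obtain ⟨y, hy, rfl⟩ := ih h h2 (fun f hf => hx f (List.mem_cons_of_mem _ hf))
    exact ⟨⟨e, h1, h2⟩ :: y, ⟨rfl, hy⟩, rfl⟩

theorem weight_map_val {C : Set V} (x : List {e : E // G.I e ∈ C ∧ G.O e ∈ C}) :
    G.weight (x.map Subtype.val) = (G.induce C).weight x := by
  simp [weight, induce]

theorem Conn.exists_lift {a u v : V} {x : List E} (h : G.Conn u v) (hau : u ∈ G.cls a)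
    (hav : v ∈ G.cls a) (hx : G.Walk u x v) :
    ∃ y, (G.induce (G.cls a)).Walk ⟨u, hau⟩ y ⟨v, hav⟩ ∧ y.map Subtype.val = x :=
  hx.exists_lift hau hav fun e he => by
    obtain ⟨h1, h2⟩ := inner_of_walk h hx he
    have h3 : G.Conn a (G.I e) := Conn.trans hau h1
    exact ⟨h3, h3.trans h2⟩

theorem IsSCC.induce_conn {C : Set V} (hC : G.IsSCC C) (u v : C) : (G.induce C).Conn u v := by
  suffices h : ∀ u v : C, ((G.induce C).paths u v).Nonempty from ⟨h u v, h v u⟩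
  obtain ⟨-, a, rfl⟩ := hC
  intro u v
  have huv : G.Conn u.1 v.1 := (Conn.symm u.2).trans v.2
  obtain ⟨x, hx⟩ := huv.1
  obtain ⟨hx0, hx⟩ := mem_paths_iff.1 hx
  obtain ⟨y, hy, rfl⟩ := huv.exists_lift u.2 v.2 hx
  exact ⟨y, hy.mem_paths (by rintro rfl; simp at hx0)⟩

theorem count_le_count_of_injective {V' E' : Type*} [Finite E] {H : WeightedDigraph V' E'}
    {f : List E' → List E} (hf : Function.Injective f) {S : Set (List E')} {X : Set (List E)}
    (hS : ∀ x ∈ S, f x ∈ X) {w : ℝ} (hw : ∀ x, G.weight (f x) = H.weight x + w) (t : ℝ) :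
    H.count S (t - w) ≤ G.count X t := by
  refine Set.ncard_le_ncard_of_injOn f ?_ hf.injOn (finite_count _ _)
  rintro x ⟨hx, hxt⟩
  exact ⟨hS x hx, by rw [hw]; linarith⟩

/-! ### Sums of exponential weights -/

variable (G) in
/-- The sum of `exp (- l * weight x)` over the elements `x` of `S`. -/
def expSum (l : ℝ) (S : Set (List E)) : ℝ≥0∞ :=
  ∑' x : S, ENNReal.ofReal (Real.exp (-(l * G.weight x.1)))

theorem expSum_mono {l : ℝ} {S T : Set (List E)} (h : S ⊆ T) : G.expSum l S ≤ G.expSum l T :=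
  ENNReal.tsum_mono_subtype (fun x => ENNReal.ofReal (Real.exp (-(l * G.weight x)))) h

theorem expSum_lt_top_of_finite {l : ℝ} {S : Set (List E)} (h : S.Finite) :
    G.expSum l S < ⊤ := by
  have := h.fintype
  rw [expSum, tsum_fintype]
  exact ENNReal.sum_lt_top.2 fun _ _ => ENNReal.ofReal_lt_top

theorem expSum_image2_le {l : ℝ} (S T : Set (List E)) :
    G.expSum l (Set.image2 (· ++ ·) S T) ≤ G.expSum l S * G.expSum l T := by
  let f : S × T → Set.image2 (· ++ ·) S T := fun p => ⟨p.1.1 ++ p.2.1, p.1.1, p.1.2, p.2.1, p.2.2, rfl⟩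
  have hf : Function.Surjective f := by
    rintro ⟨_, x, hx, y, hy, rfl⟩
    exact ⟨(⟨x, hx⟩, ⟨y, hy⟩), rfl⟩
  refine (ENNReal.tsum_le_tsum_comp_of_surjective hf _).trans (le_of_eq ?_)
  rw [ENNReal.tsum_prod', expSum, expSum, ← ENNReal.tsum_mul_right]
  refine tsum_congr fun x => ?_
  rw [← ENNReal.tsum_mul_left]
  refine tsum_congr fun y => ?_
  rw [← ENNReal.ofReal_mul (Real.exp_pos _).le, ← Real.exp_add, weight_append]
  ring_nf

theorem expSum_image_le {V' E' : Type*} {H : WeightedDigraph V' E'} {l : ℝ}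
    {f : List E' → List E} (hf : ∀ x, G.weight (f x) = H.weight x) (S : Set (List E')) :
    G.expSum l (f '' S) ≤ H.expSum l S := by
  refine (ENNReal.tsum_le_tsum_comp_of_surjective (f := fun x : S => (⟨f x.1, x.1, x.2, rfl⟩ : f '' S))
    ?_ _).trans (le_of_eq ?_)
  · rintro ⟨_, x, hx, rfl⟩
    exact ⟨⟨x, hx⟩, rfl⟩
  · simp only [hf]
    rfl

theorem count_le_mul_exp [Finite E] {l : ℝ} (hl : 0 ≤ l) {S : Set (List E)}
    (hS : G.expSum l S < ⊤) (t : ℝ) :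
    (G.count S t : ℝ) ≤ (G.expSum l S).toReal * Real.exp (l * t) := by
  have h1 : (G.count S t : ℝ≥0∞) * ENNReal.ofReal (Real.exp (-(l * t))) ≤ G.expSum l S := by
    refine le_trans ?_ (expSum_mono (l := l) (fun x hx => hx.1 :
      {x | x ∈ S ∧ G.weight x ≤ t} ⊆ S))
    have := (finite_count (G := G) S t).fintype
    rw [expSum, tsum_fintype, count, ← Nat.card_coe_set_eq, Nat.card_eq_fintype_card,
      ← nsmul_eq_mul, ← Finset.card_univ]
    refine Finset.card_nsmul_le_sum _ _ _ fun x _ => ENNReal.ofReal_le_ofReal ?_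
    exact Real.exp_le_exp.2 (neg_le_neg (mul_le_mul_of_nonneg_left x.2.2 hl))
  have h2 := ENNReal.toReal_mono hS.ne h1
  rw [ENNReal.toReal_mul, ENNReal.toReal_natCast, ENNReal.toReal_ofReal (Real.exp_pos _).le,
    Real.exp_neg, ← div_eq_mul_inv, div_le_iff₀ (Real.exp_pos _)] at h2
  exact h2

theorem expSum_walks_lt_top [Fintype V] [Fintype E] {l : ℝ} (h : G.expRadius l < 1) (j i : V) :
    G.expSum l {x | G.Walk j x i} < ⊤ := by
  classical
  have h1 : {x | G.Walk j x i} ⊆ ⋃ n, (G.walkFinset i n j : Set (List E)) := fun x hx =>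
    Set.mem_iUnion.2 ⟨x.length, mem_walkFinset.2 ⟨hx, rfl⟩⟩
  have h2 := Matrix.summable_pow_apply (expMatrix_nonneg l) h i j
  refine (expSum_mono h1).trans_lt ((ENNReal.tsum_iUnion_le_tsum
    (fun x => ENNReal.ofReal (Real.exp (-(l * G.weight x)))) _).trans_lt ?_)
  have h3 : ∀ n, ∑' x : (G.walkFinset i n j : Set (List E)),
      ENNReal.ofReal (Real.exp (-(l * G.weight x.1)))
      = ENNReal.ofReal ((G.expMatrix l ^ n) i j) := fun n => by
    rw [Finset.tsum_subtype' (G.walkFinset i n j)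
      (fun x => ENNReal.ofReal (Real.exp (-(l * G.weight x)))),
      ← ENNReal.ofReal_sum_of_nonneg fun _ _ => (Real.exp_pos _).le, expMatrix_pow_apply]
  simp only [h3]
  rw [← ENNReal.ofReal_tsum_of_nonneg (fun n => Matrix.pow_apply_nonneg (expMatrix_nonneg l) n i j)
    h2]
  exact ENNReal.ofReal_lt_top

open scoped Classical in
theorem expSum_paths_lt_top [Fintype V] [Fintype E] {l : ℝ} {a b : V} (hab : G.Conn a b)
    (h : (G.induce (G.cls a)).expRadius l < 1) : G.expSum l (G.paths a b) < ⊤ := by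
  refine lt_of_le_of_lt ?_ (expSum_walks_lt_top h ⟨a, hab.left⟩ ⟨b, hab⟩)
  refine le_trans (expSum_mono fun x hx => ?_)
    (expSum_image_le (f := List.map Subtype.val) weight_map_val _)
  obtain ⟨y, hy, rfl⟩ := hab.exists_lift hab.left hab (mem_paths_iff.1 hx).2
  exact ⟨y, hy, rfl⟩

open scoped Classical in
theorem expSum_along_lt_top [Fintype V] [Fintype E] {k : ℝ} {a : V} {l : List V}
    (h : ∀ q ∈ G.innerSteps (a :: l), (G.induce (G.cls q.1)).expRadius k < 1) :
    G.expSum k (G.along (a :: l)) < ⊤ := by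
  induction l generalizing a with
  | nil =>
    rw [along_singleton]
    exact expSum_lt_top_of_finite (Set.finite_singleton _)
  | cons b l ih =>
    by_cases hab : G.Conn a b
    · rw [innerSteps_of_conn hab] at h
      refine lt_of_le_of_lt ?_ (ENNReal.mul_lt_top (expSum_paths_lt_top hab (h (a, b) (by simp)))
        (ih fun q hq => h q (List.mem_cons_of_mem _ hq)))
      refine le_trans (expSum_mono ?_) (expSum_image2_le _ _)
      rw [along_of_conn hab]
      rintro _ ⟨y, hy, z, hz, rfl⟩
      exact ⟨y, hy, z, hz, rfl⟩
    · rw [innerSteps_of_not_conn hab] at h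
      refine lt_of_le_of_lt ?_ (ENNReal.mul_lt_top (expSum_lt_top_of_finite (G := G) (l := k)
        (Set.finite_range fun e : E => [e])) (ih h))
      refine le_trans (expSum_mono ?_) (expSum_image2_le _ _)
      rw [along_of_not_conn hab]
      rintro _ ⟨e, -, -, z, hz, rfl⟩
      exact ⟨[e], ⟨e, rfl⟩, z, hz, rfl⟩

open scoped Classical in
theorem count_paths_le [Fintype V] [Fintype E] {u v : V} {k : ℝ} (hk : 0 ≤ k)
    (h : ∀ C, G.IsSCCOn (G.paths u v) C → (G.induce C).expRadius k < 1) :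
    ∃ K : ℝ, ∀ t, (G.count (G.paths u v) t : ℝ) ≤ K * Real.exp (k * t) := by
  refine ⟨_, count_le_mul_exp hk ?_⟩
  conv => arg 1; arg 3; rw [paths_eq_biUnion]
  refine (ENNReal.tsum_biUnion_le (fun x => ENNReal.ofReal (Real.exp (-(k * G.weight x)))) _
    G.along).trans_lt (ENNReal.sum_lt_top.2 fun σ hσ => ?_)
  rw [Set.Finite.mem_toFinset] at hσ
  obtain ⟨x, hx, rfl⟩ := hσ
  have h1 := fun q hq => h _ (isSCCOn_of_mem_innerSteps hx (q := q) hq)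
  obtain ⟨l, hl, -⟩ := exists_itin_eq_cons hx
  rw [hl] at h1 ⊢
  exact expSum_along_lt_top h1

open scoped Classical in
theorem exp_le_count_paths [Fintype V] [Fintype E] {u v : V} {k : ℝ} (hk : 0 < k) {C : Set V}
    (hC : G.IsSCCOn (G.paths u v) C) (h : 1 < (G.induce C).expRadius k) :
    ∃ K : ℝ, 0 < K ∧ ∀ᶠ t in atTop, K * Real.exp (k * t) ≤ G.count (G.paths u v) t := by
  obtain ⟨a, M, hM⟩ := exists_exp_le_count hC.1.induce_conn hk h
  obtain ⟨y, z, hyz, hy, hz⟩ := mem_vertsOf_paths_iff.1 (hC.2 a.2)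
  set w := G.weight y + G.weight z
  refine ⟨Real.exp (-(k * (w + M))), Real.exp_pos _, ?_⟩
  filter_upwards [eventually_ge_atTop w] with t ht
  have h1 := count_le_count_of_injective (G := G) (H := G.induce C)
    (f := fun x => y ++ (x.map Subtype.val ++ z)) (S := {x | (G.induce C).Walk a x a})
    (X := G.paths u v) (w := w) ?_ ?_ ?_ t
  · have h2 := hM (t - w) (by linarith)
    rw [← Real.exp_add]
    refine le_trans (le_of_eq ?_) (h2.trans (by exact_mod_cast h1))
    ring_nf
  · intro x x' hx
    exact List.map_injective_iff.2 Subtype.val_injective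
      (List.append_cancel_right (List.append_cancel_left hx))
  · intro x hx
    refine (hy.append (hx.map_val.append hz)).mem_paths ?_
    simp only [ne_eq, List.append_eq_nil_iff] at hyz ⊢
    tauto
  · intro x
    simp only [weight_append, weight_map_val, w]
    ring

open scoped Classical in
theorem exists_isLeast_isDecayConstOf [Fintype V] [Fintype E] {X : Set (List E)}
    (hX : ∃ C, G.IsSCCOn X C ∧ ¬ (G.induce C).IsCycle)
    (hu : ∀ C, G.IsSCCOn X C → ¬ (G.induce C).IsCycle → ∃! t, G.IsDecayConstOf C t) :
    ∃ s, IsLeast {t | ∃ C, G.IsSCCOn X C ∧ ¬ (G.induce C).IsCycle ∧ G.IsDecayConstOf C t} s := by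
  have hfin : {t | ∃ C, G.IsSCCOn X C ∧ ¬ (G.induce C).IsCycle ∧ G.IsDecayConstOf C t}.Finite := by
    have : {t | ∃ C, G.IsSCCOn X C ∧ ¬ (G.induce C).IsCycle ∧ G.IsDecayConstOf C t}
        = ⋃ C, {t | G.IsSCCOn X C ∧ ¬ (G.induce C).IsCycle ∧ G.IsDecayConstOf C t} := by
      ext t
      simp
    rw [this]
    refine Set.finite_iUnion fun C => Set.Subsingleton.finite ?_
    rintro t ⟨h1, h2, h3⟩ t' ⟨-, -, h3'⟩
    exact (hu C h1 h2).unique h3 h3'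
  obtain ⟨C, h1, h2⟩ := hX
  obtain ⟨t, ht, -⟩ := hu C h1 h2
  obtain ⟨s, hs, hmin⟩ := Set.exists_min_image _ id hfin ⟨t, C, h1, h2, ht⟩
  exact ⟨s, hs, fun t ht => hmin t ht⟩

end WeightedDigraph
end

open WeightedDigraph

theorem theorem1 {V E : Type*} [Fintype V] [Fintype E] (G : WeightedDigraph V E) (v₁ v₂ : V)
    (X : Set (List E)) (hX : X = G.paths v₁ v₂) (hne : X.Nonempty) :
    -- no components: finitely many paths
    ((¬ ∃ C, G.IsSCCOn X C) → X.Finite) ∧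
    -- there are components, and all of them are cycles
    ((∃ C, G.IsSCCOn X C) → (∀ C, G.IsSCCOn X C → (G.induce C).IsCycle) →
      (∃ p, G.IsSeqOfWeights X p) ∧
      ∃ c : ℕ, IsGreatest {k | ∃ x ∈ X, G.numSCC x = k} c ∧ 1 ≤ c ∧ 0 < G.cycleLimit X c ∧
        ∀ p, G.IsSeqOfWeights X p →
          Tendsto (fun r : ℕ => p r ^ c / (r : ℝ)) atTop (𝓝 (G.cycleLimit X c))) ∧
    -- some component is not a cycle
    ((∃ C, G.IsSCCOn X C ∧ ¬ (G.induce C).IsCycle) →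
      (∃ p, G.IsSeqOfWeights X p) ∧
      (∀ C, G.IsSCCOn X C → ¬ (G.induce C).IsCycle → ∃! t, G.IsDecayConstOf C t) ∧
      ∃ s : ℝ, IsLeast {t | ∃ C, G.IsSCCOn X C ∧ ¬ (G.induce C).IsCycle ∧
          G.IsDecayConstOf C t} s ∧
        ∀ p, G.IsSeqOfWeights X p →
          Tendsto (fun r : ℕ => p r / Real.log (r : ℝ)) atTop (𝓝 s)) := by
  classical
  subst hX
  refine ⟨fun h => paths_finite h, fun hex hcyc => ?_, fun hex => ?_⟩
  · obtain ⟨c, hc⟩ := exists_isGreatest_numSCC (G := G) hne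
    have hc1 := one_le_of_isGreatest_numSCC hc hex
    obtain ⟨hpos, hgrowth⟩ := growth_paths hcyc hc
    refine ⟨exists_isSeqOfWeights (hgrowth.infinite hc1 hpos), c, hc, hc1, inv_pos.1 hpos,
      fun p hp => ?_⟩
    simpa only [inv_inv] using hp.tendsto_pow_div hpos hgrowth
  · have hu : ∀ C, G.IsSCCOn (G.paths v₁ v₂) C → ¬ (G.induce C).IsCycle →
        ∃! t, G.IsDecayConstOf C t :=
      fun C hC hcyc => existsUnique_isDecayConst hC.1.induce_conn hcyc
    obtain ⟨s, hs⟩ := exists_isLeast_isDecayConstOf hex hu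
    obtain ⟨C, hC, hCcyc, hCs⟩ := hs.1
    obtain ⟨hs0, hrad⟩ := isDecayConst_iff.1 hCs
    have hlower : ∀ l, 0 < l → l < s⁻¹ → ∃ K : ℝ, 0 < K ∧
        ∀ᶠ t in atTop, K * Real.exp (l * t) ≤ G.count (G.paths v₁ v₂) t :=
      fun l hl hls => exp_le_count_paths hl hC (one_lt_expRadius hrad hls)
    have hupper : ∀ l, s⁻¹ < l →
        ∃ K : ℝ, ∀ t, (G.count (G.paths v₁ v₂) t : ℝ) ≤ K * Real.exp (l * t) := by
      intro l hl
      have hl0 := (inv_pos.2 hs0).trans hl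
      refine count_paths_le hl0.le fun D hD => ?_
      have := hD.1.1.to_subtype
      by_cases hDcyc : (G.induce D).IsCycle
      · exact hDcyc.expRadius_lt_one hl0
      · obtain ⟨t, ht, -⟩ := hu D hD hDcyc
        obtain ⟨ht0, htrad⟩ := isDecayConst_iff.1 ht
        exact expRadius_lt_one htrad ((inv_anti₀ hs0 (hs.2 ⟨D, hD, hDcyc, ht⟩)).trans_lt hl)
    refine ⟨exists_isSeqOfWeights ?_, hu, s, hs, fun p hp => hp.tendsto_div_log hs0 hupper hlower⟩
    refine infinite_of_count_unbounded (G := G) fun n => ?_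
    have hl : 0 < s⁻¹ / 2 := by positivity
    obtain ⟨K, hK, hKt⟩ := hlower (s⁻¹ / 2) hl (by linarith)
    have h1 : Tendsto (fun t => K * Real.exp (s⁻¹ / 2 * t)) atTop atTop :=
      (Real.tendsto_exp_atTop.comp (tendsto_id.const_mul_atTop hl)).const_mul_atTop hK
    obtain ⟨t, ht, ht'⟩ := (hKt.and (h1.eventually_gt_atTop n)).exists
    exact ⟨t, by exact_mod_cast ht'.trans_le ht⟩
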